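/- Let $X=(X_s)_{s\in\mathbb{R}}$ and $Y=(Y_s)_{s\in\mathbb{R}}$ be independent copies of the one-dimensional Ornstein–Uhlenbeck process, that is, of the (almost surely continuous) centred Gaussian process with covariance $\mathbb{E}[X_sX_t]=e^{-|s-t|}$. For an integer $N\ge 1$ and $\beta>0$ put $$E^N_\beta=\mathbb{E}\Big[\prod_{k=0}^{N-1}\big(X_{\beta k}^2+Y_{\beta k}^2\big)\Big].$$ Let $\beta=\beta(N)$, $N\ge1$, be a sequence of positive real numbers. Then the following hold as $N\to\infty$, where $f\ll g$ means $f/g\to 0$, and $f=O(g)$ means that there is a constant $C$ (which may depend on the sequence $\beta(\cdot)$) with $|f|\le C|g|$ for all sufficiently large $N$. (i) If $1/N\ll\beta\ll 1$, then $$\frac1N\log E^N_\beta=\log\frac{4}{\beta}-1+O(\beta)+O\Big(\frac{1}{\beta N}\Big).$$ (ii) If $\beta\ll 1/N$, then $$\frac1N\log E^N_\beta=\frac1N\log(N!)+\log 2-\beta\Big(\frac N3-\frac1{3N}\Big)+O(\beta^2N^2).$$ -/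

import Mathlib

open Filter Asymptotics MeasureTheory ProbabilityTheory

/-- Covariance matrix `e^{-|tᵢ - tⱼ|}` of the one-dimensional Ornstein-Uhlenbeck process `Ψ`
at the times `tᵢ`. -/
noncomputable def ouCov {ι : Type*} (t : ι → ℝ) : Matrix ι ι ℝ :=
  Matrix.of fun i j => Real.exp (-|t i - t j|)

/-- The matrix is positive semidefinite, so that `multivariateGaussian 0 (ouCov t)` really is the
centred Gaussian law with this covariance. -/
theorem posSemidef_ouCov {ι : Type*} [Finite ι] (t : ι → ℝ) : (ouCov t).PosSemidef := by
  classical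
  have := Fintype.ofFinite ι
  have h1 : (Matrix.of fun i j : ι =>
      volume.real (Set.Icc 0 (Real.exp (2 * t i)) ∩ Set.Icc 0 (Real.exp (2 * t j)))).PosSemidef :=
    posSemidef_matrix_measure_inter (fun _ => measurableSet_Icc)
      (fun _ => isCompact_Icc.measure_ne_top)
  have h2 := h1.conjTranspose_mul_mul_same (Matrix.diagonal fun i => Real.exp (-t i))
  convert h2 using 1
  ext i j
  simp only [ouCov, Matrix.diagonal_conjTranspose, Matrix.mul_diagonal, Matrix.diagonal_mul,
    Matrix.of_apply, Set.Icc_inter_Icc, max_self, star_trivial, ← Real.exp_monotone.map_min]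
  rw [Real.volume_real_Icc_of_le (Real.exp_pos _).le, sub_zero, ← Real.exp_add, ← Real.exp_add]
  congr 1
  rcases le_total (t i) (t j) with h | h
  · rw [min_eq_left (by linarith), abs_of_nonpos (by linarith)]; ring
  · rw [min_eq_right (by linarith), abs_of_nonneg (by linarith)]; ring

/-- The law of `(Ψ(tᵢ))ᵢ`, where `Ψ` is the Ornstein-Uhlenbeck process, i.e. the centred Gaussian
process on `ℝ` with `𝔼[Ψ(s)Ψ(t)] = e^{-|s-t|}`. -/
noncomputable def ouLaw {ι : Type*} [Fintype ι] [DecidableEq ι] (t : ι → ℝ) :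
    Measure (EuclideanSpace ℝ ι) :=
  multivariateGaussian 0 (ouCov t)

/-- The points `0, β, 2β, …, (N-1)β` of the rescaled lattice box. -/
noncomputable def latticeTimes (N : ℕ) (β : ℝ) : Fin N → ℝ := fun k => β * (k : ℝ)

/-- `E^N_β = 𝔼[∏ₓ (X_x² + Y_x²)]`, the product being over `x ∈ {0, β, …, (N-1)β}` and
`X`, `Y` being independent Ornstein-Uhlenbeck processes. -/
noncomputable def gaussianMoment (N : ℕ) (β : ℝ) : ℝ :=
  ∫ p : EuclideanSpace ℝ (Fin N) × EuclideanSpace ℝ (Fin N),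
    ∏ k, ((p.1 k) ^ 2 + (p.2 k) ^ 2)
    ∂((ouLaw (latticeTimes N β)).prod (ouLaw (latticeTimes N β)))

/-- The integral that defines `gaussianMoment` converges. -/
theorem integrable_gaussianMoment (N : ℕ) (β : ℝ) :
    Integrable (fun p : EuclideanSpace ℝ (Fin N) × EuclideanSpace ℝ (Fin N) =>
      ∏ k, ((p.1 k) ^ 2 + (p.2 k) ^ 2))
      ((ouLaw (latticeTimes N β)).prod (ouLaw (latticeTimes N β))) := by
  unfold ouLaw
  set μ := multivariateGaussian 0 (ouCov (latticeTimes N β))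
  have h : MemLp id ((2 * N : ℕ) : ENNReal) (μ.prod μ) :=
    IsGaussian.memLp_id _ _ (ENNReal.natCast_ne_top _)
  have h' := (h.integrable_norm_pow').const_mul ((2 : ℝ) ^ N)
  refine h'.mono' ?_ (Eventually.of_forall fun p => ?_)
  · exact Measurable.aestronglyMeasurable (by fun_prop)
  · have hk : ∀ k ∈ (Finset.univ : Finset (Fin N)),
        ‖(p.1 k) ^ 2 + (p.2 k) ^ 2‖ ≤ 2 * ‖p‖ ^ 2 := fun k _ => by
      have a1 : ‖p.1 k‖ ≤ ‖p‖ := (PiLp.norm_apply_le p.1 k).trans (norm_fst_le p)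
      have a2 : ‖p.2 k‖ ≤ ‖p‖ := (PiLp.norm_apply_le p.2 k).trans (norm_snd_le p)
      have b1 := pow_le_pow_left₀ (norm_nonneg _) a1 2
      have b2 := pow_le_pow_left₀ (norm_nonneg _) a2 2
      refine (norm_add_le _ _).trans ?_
      rw [norm_pow, norm_pow]
      linarith
    rw [norm_prod]
    refine (Finset.prod_le_prod (fun _ _ => norm_nonneg _) hk).trans (le_of_eq ?_)
    simp [mul_pow, pow_mul]

/-- For independent centred Gaussian processes `X`, `Y` on `ℝ` with covariance `e^{-|s-t|}`, on any
probability space, the expectation of `∏ₓ (X_x² + Y_x²)` is `gaussianMoment N β`. -/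
theorem integral_eq_gaussianMoment {Ω : Type*} [MeasurableSpace Ω] {P : Measure Ω}
    {X Y : ℝ → Ω → ℝ} (hX : IsGaussianProcess X P) (hY : IsGaussianProcess Y P)
    (hX0 : ∀ s, ∫ ω, X s ω ∂P = 0) (hY0 : ∀ s, ∫ ω, Y s ω ∂P = 0)
    (hXc : ∀ s t, cov[X s, X t; P] = Real.exp (-|s - t|))
    (hYc : ∀ s t, cov[Y s, Y t; P] = Real.exp (-|s - t|))
    (hXY : IndepFun (fun ω s => X s ω) (fun ω s => Y s ω) P) (N : ℕ) (β : ℝ) :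
    ∫ ω, ∏ k ∈ Finset.range N, (X (β * (k : ℝ)) ω ^ 2 + Y (β * (k : ℝ)) ω ^ 2) ∂P
      = gaussianMoment N β := by
  have key : ∀ Z : ℝ → Ω → ℝ, IsGaussianProcess Z P → (∀ s, ∫ ω, Z s ω ∂P = 0) →
      (∀ s t, cov[Z s, Z t; P] = Real.exp (-|s - t|)) →
      HasLaw (fun ω => WithLp.toLp 2 fun k : Fin N => Z (latticeTimes N β k) ω)
        (ouLaw (latticeTimes N β)) P := by
    intro Z hZ hZ0 hZc
    have := hZ.isProbabilityMeasure
    have hm : AEMeasurable (fun ω => fun k : Fin N => Z (latticeTimes N β k) ω) P :=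
      aemeasurable_pi_lambda _ fun _ => hZ.aemeasurable _
    have hm' : AEMeasurable (fun ω => WithLp.toLp 2 fun k : Fin N => Z (latticeTimes N β k) ω) P :=
      (MeasurableEquiv.toLp 2 (Fin N → ℝ)).measurable.comp_aemeasurable hm
    have hG : HasGaussianLaw
        (fun ω => WithLp.toLp 2 fun k : Fin N => Z (latticeTimes N β k) ω) P := by
      have h1 := (hZ.comp_right (latticeTimes N β)).hasGaussianLaw Finset.univ
      exact h1.map_fun ((PiLp.continuousLinearEquiv 2 ℝ
        (fun _ : Fin N => ℝ)).symm.toContinuousLinearMap.comp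
        (ContinuousLinearMap.pi fun k : Fin N =>
          ContinuousLinearMap.proj (R := ℝ) (φ := fun _ : (Finset.univ : Finset (Fin N)) => ℝ)
            ⟨k, Finset.mem_univ k⟩))
    have hmem : ∀ k : Fin N, MemLp (Z (latticeTimes N β k)) 2 P :=
      fun k => (hZ.hasGaussianLaw_eval _).memLp_two
    refine ⟨hm', ?_⟩
    have := hG.isGaussian_map
    have hg : IsGaussian (ouLaw (latticeTimes N β)) := by unfold ouLaw; infer_instance
    apply IsGaussian.ext
    · have e2 : (ouLaw (latticeTimes N β))[id] = 0 := by simp [ouLaw]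
      rw [e2, integral_map hm' (by fun_prop)]
      ext k
      have e3 := (EuclideanSpace.proj (𝕜 := ℝ) k).integral_comp_comm hG.integrable
      simpa [hZ0] using e3.symm
    · ext x y
      rw [covarianceBilin_apply_pi hmem]
      unfold ouLaw
      rw [covarianceBilin_multivariateGaussian (posSemidef_ouCov _)]
      simp only [hZc, ouCov, dotProduct, Matrix.mulVec, Finset.mul_sum, Matrix.of_apply]
      refine Finset.sum_congr rfl fun i _ => Finset.sum_congr rfl fun j _ => ?_
      ring
  have hφ : Measurable fun (w : ℝ → ℝ) => WithLp.toLp 2 fun k : Fin N => w (latticeTimes N β k) :=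
    (MeasurableEquiv.toLp 2 (Fin N → ℝ)).measurable.comp
      (measurable_pi_lambda _ fun _ => measurable_pi_apply _)
  have := hX.isProbabilityMeasure
  have hlaw := (hXY.comp hφ hφ).hasLaw_prod (key X hX hX0 hXc) (key Y hY hY0 hYc)
  rw [gaussianMoment, ← hlaw.map_eq, integral_map hlaw.aemeasurable
    (Measurable.aestronglyMeasurable (by fun_prop))]
  refine integral_congr_ae (Eventually.of_forall fun ω => ?_)
  simp only [Finset.prod_range, latticeTimes]

/-- Iterates of the Jacobi operator of the Laguerre polynomials, damped by `r ^ n` on both sides,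
applied to the zeroth basis vector. -/
noncomputable def chainWeight (r : ℝ) : ℕ → ℕ → ℝ
  | 0, n => if n = 0 then 1 else 0
  | N + 1, n => r ^ n * ((n + 1) * (r ^ (n + 1) * chainWeight r N (n + 1))
      + (2 * n + 1) * (r ^ n * chainWeight r N n)
      + n * (r ^ (n - 1) * chainWeight r N (n - 1)))

theorem chainWeight_nonneg {r : ℝ} (hr : 0 ≤ r) (N n : ℕ) : 0 ≤ chainWeight r N n := by
  induction N generalizing n with
  | zero => simp only [chainWeight]; split_ifs <;> norm_num
  | succ N ih =>
    have := ih (n + 1)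
    have := ih n
    have := ih (n - 1)
    simp only [chainWeight]
    positivity

theorem chainWeight_le_pow {r l : ℝ} (hr : 0 ≤ r) (hl : 0 ≤ l)
    (h : ∀ n : ℕ, r ^ n * ((n + 1) * r ^ (n + 1) + (2 * n + 1) * r ^ n + n * r ^ (n - 1)) ≤ l)
    (N n : ℕ) : chainWeight r N n ≤ l ^ N := by
  induction N generalizing n with
  | zero => simp only [chainWeight]; split_ifs <;> norm_num
  | succ N ih =>
    simp only [chainWeight]
    calc _ ≤ r ^ n * ((n + 1) * (r ^ (n + 1) * l ^ N) + (2 * n + 1) * (r ^ n * l ^ N)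
          + n * (r ^ (n - 1) * l ^ N)) := by gcongr <;> apply ih
      _ = r ^ n * ((n + 1) * r ^ (n + 1) + (2 * n + 1) * r ^ n + n * r ^ (n - 1)) * l ^ N := by ring
      _ ≤ l * l ^ N := by gcongr; exact h n
      _ = l ^ (N + 1) := by ring

theorem mul_exp_neg_le (t : ℝ) : t * Real.exp (-t) ≤ Real.exp (-1) := by
  have h := Real.add_one_le_exp (t - 1)
  have h2 : Real.exp (-1) = Real.exp (t - 1) * Real.exp (-t) := by rw [← Real.exp_add]; ring_nf
  rw [h2]
  gcongr
  linarith

theorem chainWeight_exp_le {b : ℝ} (hb : 0 < b) (N n : ℕ) :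
    chainWeight (Real.exp (-b)) N n ≤ (2 / b * Real.exp (-1) * Real.exp (2 * b)) ^ N := by
  refine chainWeight_le_pow (by positivity) (by positivity) (fun n => ?_) N n
  have hE : ∀ k : ℕ, Real.exp (-b) ^ k = Real.exp (-(b * k)) := fun k => by
    rw [← Real.exp_nat_mul]; ring_nf
  have key := mul_exp_neg_le (2 * b * (n + 1 / 2))
  have h1 : Real.exp (-b) ^ n * Real.exp (-b) ^ (n + 1)
      ≤ Real.exp (2 * b) * Real.exp (-(2 * b * (n + 1 / 2))) := by
    rw [hE, hE, ← Real.exp_add, ← Real.exp_add]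
    apply Real.exp_le_exp.2; push_cast; linarith
  have h2 : Real.exp (-b) ^ n * Real.exp (-b) ^ n
      ≤ Real.exp (2 * b) * Real.exp (-(2 * b * (n + 1 / 2))) := by
    rw [hE, ← Real.exp_add, ← Real.exp_add]
    apply Real.exp_le_exp.2; linarith
  have h3 : n * (Real.exp (-b) ^ n * Real.exp (-b) ^ (n - 1))
      ≤ n * (Real.exp (2 * b) * Real.exp (-(2 * b * (n + 1 / 2)))) := by
    rcases n with _ | n
    · simp
    · refine mul_le_mul_of_nonneg_left ?_ (by positivity)
      rw [hE, hE, ← Real.exp_add, ← Real.exp_add]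
      apply Real.exp_le_exp.2; push_cast; simp; linarith
  calc _ = (n + 1) * (Real.exp (-b) ^ n * Real.exp (-b) ^ (n + 1))
        + (2 * n + 1) * (Real.exp (-b) ^ n * Real.exp (-b) ^ n)
        + n * (Real.exp (-b) ^ n * Real.exp (-b) ^ (n - 1)) := by ring
    _ ≤ (n + 1) * (Real.exp (2 * b) * Real.exp (-(2 * b * (n + 1 / 2))))
        + (2 * n + 1) * (Real.exp (2 * b) * Real.exp (-(2 * b * (n + 1 / 2))))
        + n * (Real.exp (2 * b) * Real.exp (-(2 * b * (n + 1 / 2)))) := by gcongr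
    _ = 2 / b * (2 * b * (n + 1 / 2) * Real.exp (-(2 * b * (n + 1 / 2)))) * Real.exp (2 * b) := by
      field_simp; ring
    _ ≤ _ := by gcongr

section Jensen

variable {w₁ w₂ w₃ y₁ y₂ y₃ W m : ℝ}

theorem mul_exp_neg_le_sum_three (h₁ : 0 ≤ w₁) (h₂ : 0 ≤ w₂) (h₃ : 0 ≤ w₃)
    (hW : w₁ + w₂ + w₃ = W) (hm : w₁ * y₁ + w₂ * y₂ + w₃ * y₃ = W * m) :
    W * Real.exp (-m) ≤ w₁ * Real.exp (-y₁) + w₂ * Real.exp (-y₂) + w₃ * Real.exp (-y₃) := by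
  have key : ∀ y, Real.exp (-m) * (1 - (y - m)) ≤ Real.exp (-y) := fun y => by
    have h := Real.add_one_le_exp (-(y - m))
    have : Real.exp (-y) = Real.exp (-m) * Real.exp (-(y - m)) := by
      rw [← Real.exp_add]; ring_nf
    rw [this]
    gcongr
    linarith
  calc W * Real.exp (-m) = w₁ * (Real.exp (-m) * (1 - (y₁ - m)))
        + w₂ * (Real.exp (-m) * (1 - (y₂ - m))) + w₃ * (Real.exp (-m) * (1 - (y₃ - m))) := by
        linear_combination (-Real.exp (-m) * (1 + m)) * hW + Real.exp (-m) * hm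
    _ ≤ _ := by gcongr <;> apply key

theorem sum_three_le_mul_exp {c : ℝ} (h₁ : 0 ≤ w₁) (h₂ : 0 ≤ w₂) (h₃ : 0 ≤ w₃)
    (hW : w₁ + w₂ + w₃ = W) (hm : w₁ * y₁ + w₂ * y₂ + w₃ * y₃ = W * m) (hc : c ≤ 1)
    (hy₁ : |y₁ - m| ≤ c) (hy₂ : |y₂ - m| ≤ c) (hy₃ : |y₃ - m| ≤ c) :
    w₁ * Real.exp (-y₁) + w₂ * Real.exp (-y₂) + w₃ * Real.exp (-y₃)
      ≤ W * Real.exp (-m) * Real.exp (c ^ 2) := by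
  have key : ∀ y, |y - m| ≤ c → Real.exp (-y) ≤ Real.exp (-m) * (1 - (y - m) + c ^ 2) := by
    intro y hy
    have h := Real.abs_exp_sub_one_sub_id_le (x := -(y - m)) (by rw [abs_neg]; linarith)
    have h' := (abs_le.1 h).2
    have h2 : (-(y - m)) ^ 2 ≤ c ^ 2 := by rw [neg_sq, ← sq_abs]; gcongr
    have : Real.exp (-y) = Real.exp (-m) * Real.exp (-(y - m)) := by
      rw [← Real.exp_add]; ring_nf
    rw [this]
    gcongr
    linarith
  have hW0 : 0 ≤ W := by rw [← hW]; positivity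
  calc _ ≤ w₁ * (Real.exp (-m) * (1 - (y₁ - m) + c ^ 2))
        + w₂ * (Real.exp (-m) * (1 - (y₂ - m) + c ^ 2))
        + w₃ * (Real.exp (-m) * (1 - (y₃ - m) + c ^ 2)) := by
        gcongr <;> apply key <;> assumption
    _ = W * Real.exp (-m) * (c ^ 2 + 1) := by
        linear_combination (Real.exp (-m) * (1 + m + c ^ 2)) * hW - Real.exp (-m) * hm
    _ ≤ _ := by gcongr; exact Real.add_one_le_exp _

end Jensen

/-- Slope of the mean total damping as a function of the height. -/
noncomputable def meanSlope (s : ℕ) : ℝ := (2 * (s : ℝ) ^ 2 + 1) / (3 * s)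

theorem choose_succ_mul_sub (s n : ℕ) :
    ((s + 1).choose n : ℝ) * (s + 1 - n) = (s + 1) * s.choose n := by
  rcases le_or_gt n (s + 1) with h | h
  · have := Nat.choose_mul_succ_eq s n
    have h2 : ((s + 1 - n : ℕ) : ℝ) = (s : ℝ) + 1 - n := by push_cast [Nat.cast_sub h]; ring
    rw [← h2]
    exact_mod_cast (by linarith : (s + 1).choose n * (s + 1 - n) = (s + 1) * s.choose n)
  · rw [Nat.choose_eq_zero_of_lt h, Nat.choose_eq_zero_of_lt (by omega : s < n)]; simp

theorem succ_mul_choose_succ (s n : ℕ) :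
    ((n : ℝ) + 1) * s.choose (n + 1) = s.choose n * (s - n) := by
  rcases le_or_gt n s with h | h
  · have := Nat.choose_succ_right_eq s n
    have h2 : ((s - n : ℕ) : ℝ) = (s : ℝ) - n := by push_cast [Nat.cast_sub h]; ring
    rw [← h2]
    exact_mod_cast (by linarith : (n + 1) * s.choose (n + 1) = s.choose n * (s - n))
  · rw [Nat.choose_eq_zero_of_lt h, Nat.choose_eq_zero_of_lt (by omega : s < n + 1)]; simp

theorem mul_choose_pred (s n : ℕ) :
    ((s : ℝ) + 1) * (n * s.choose (n - 1)) = (s + 1).choose n * n ^ 2 := by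
  rcases n with _ | n
  · simp
  · have := Nat.add_one_mul_choose_eq s n
    have h : ((s : ℝ) + 1) * s.choose n = (s + 1).choose (n + 1) * (n + 1) := by
      exact_mod_cast this
    simp only [Nat.add_sub_cancel]
    push_cast
    linear_combination ((n : ℝ) + 1) * h

theorem exp_pow_mul (b : ℝ) (n : ℕ) (x : ℝ) :
    Real.exp (-b) ^ n * Real.exp (-x) = Real.exp (-(b * n + x)) := by
  rw [← Real.exp_nat_mul, ← Real.exp_add]; ring_nf

/-- The three weights of a step, their sum and their first moment. -/
theorem step_weights (s n : ℕ) (hs : 1 ≤ s) (b : ℝ) :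
    ∃ w₁ w₂ w₃ : ℝ, 0 ≤ w₁ ∧ 0 ≤ w₂ ∧ 0 ≤ w₃ ∧
      w₁ = (n + 1) * s.choose (n + 1) ∧ w₂ = (2 * n + 1) * s.choose n ∧
      w₃ = n * s.choose (n - 1) ∧
      w₁ + w₂ + w₃ = (s + 1) * (s + 1).choose n ∧
      w₁ * (b * (n + 1) + b * (meanSlope s * (n + 1) + ((s : ℝ) ^ 2 - 1) / 3))
        + w₂ * (b * n + b * (meanSlope s * n + ((s : ℝ) ^ 2 - 1) / 3))
        + w₃ * (b * (n - 1) + b * (meanSlope s * (n - 1) + ((s : ℝ) ^ 2 - 1) / 3))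
        = (s + 1) * (s + 1).choose n *
          (b * (meanSlope (s + 1) * n + (((s : ℝ) + 1) ^ 2 - 1) / 3) - b * n) := by
  refine ⟨_, _, _, by positivity, by positivity, by positivity, rfl, rfl, rfl, ?_, ?_⟩
  all_goals
    have h1 := choose_succ_mul_sub s n
    have h2 := succ_mul_choose_succ s n
    have h3 := mul_choose_pred s n
    have hs' : (0 : ℝ) < s := by exact_mod_cast hs
    have e1 : (s.choose n : ℝ) = (s + 1).choose n * (s + 1 - n) / (s + 1) := by
      field_simp; linarith
    have e3 : (n * s.choose (n - 1) : ℝ) = (s + 1).choose n * n ^ 2 / (s + 1) := by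
      field_simp; linarith
    rw [h2, e3, e1]
  · field_simp; ring
  · unfold meanSlope; push_cast; field_simp; ring

theorem chainWeight_ge_of_permanent {b : ℝ} (s : ℕ) (hs : 1 ≤ s) (n : ℕ) :
    s.factorial * s.choose n * Real.exp (-(b * (meanSlope s * n + ((s : ℝ) ^ 2 - 1) / 3)))
      ≤ chainWeight (Real.exp (-b)) s n := by
  induction s, hs using Nat.le_induction generalizing n with
  | base =>
    rcases n with _ | _ | n
    · simp [chainWeight]
    · simp [chainWeight, meanSlope]; norm_num
    · simp only [chainWeight]; simp [Nat.choose_eq_zero_of_lt]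
  | succ s hs ih =>
    obtain ⟨w₁, w₂, w₃, p1, p2, p3, e1, e2, e3, hW, hm⟩ := step_weights s n hs b
    have J := mul_exp_neg_le_sum_three p1 p2 p3 hW hm
    have hn3 : (n : ℝ) * ((s.factorial * s.choose (n - 1)) * Real.exp (-(b * (n - 1)
          + b * (meanSlope s * (n - 1) + ((s : ℝ) ^ 2 - 1) / 3))))
        ≤ n * (Real.exp (-b) ^ (n - 1) * chainWeight (Real.exp (-b)) s (n - 1)) := by
      rcases n with _ | n
      · simp
      · refine mul_le_mul_of_nonneg_left ?_ (by positivity)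
        have := ih n
        have h' := exp_pow_mul b n (b * (meanSlope s * n + ((s : ℝ) ^ 2 - 1) / 3))
        simp only [Nat.add_sub_cancel]
        push_cast
        rw [show (n : ℝ) + 1 - 1 = n by ring, ← h']
        calc _ = Real.exp (-b) ^ n * (s.factorial * s.choose n *
              Real.exp (-(b * (meanSlope s * n + ((s : ℝ) ^ 2 - 1) / 3)))) := by ring
          _ ≤ _ := by gcongr
    have hn1 := ih (n + 1)
    have hn2 := ih n
    have h1' := exp_pow_mul b (n + 1) (b * (meanSlope s * ((n + 1 : ℕ) : ℝ) + ((s : ℝ) ^ 2 - 1) / 3))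
    have h2' := exp_pow_mul b n (b * (meanSlope s * n + ((s : ℝ) ^ 2 - 1) / 3))
    have h0' := exp_pow_mul b n (b * (meanSlope (s + 1) * n + (((s : ℝ) + 1) ^ 2 - 1) / 3) - b * n)
    push_cast at h1' hn1
    simp only [chainWeight]
    calc _ = Real.exp (-b) ^ n * (s.factorial * ((s + 1) * (s + 1).choose n * Real.exp
            (-(b * (meanSlope (s + 1) * n + (((s : ℝ) + 1) ^ 2 - 1) / 3) - b * n)))) := by
          rw [show b * (meanSlope (s + 1) * n + (((s + 1 : ℕ) : ℝ) ^ 2 - 1) / 3)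
            = b * n + (b * (meanSlope (s + 1) * n + (((s : ℝ) + 1) ^ 2 - 1) / 3) - b * n) by
            push_cast; ring, ← h0', Nat.factorial_succ]
          push_cast; ring
      _ ≤ Real.exp (-b) ^ n * (s.factorial * (w₁ * _ + w₂ * _ + w₃ * _)) := by gcongr
      _ = Real.exp (-b) ^ n * ((n + 1) * (Real.exp (-b) ^ (n + 1) * (s.factorial *
            s.choose (n + 1) * Real.exp
              (-(b * (meanSlope s * (n + 1) + ((s : ℝ) ^ 2 - 1) / 3)))))
          + (2 * n + 1) * (Real.exp (-b) ^ n * (s.factorial * s.choose n *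
            Real.exp (-(b * (meanSlope s * n + ((s : ℝ) ^ 2 - 1) / 3)))))
          + n * ((s.factorial * s.choose (n - 1)) * Real.exp (-(b * (n - 1)
          + b * (meanSlope s * (n - 1) + ((s : ℝ) ^ 2 - 1) / 3))))) := by
          rw [← h1', ← h2', e1, e2, e3]; ring
      _ ≤ _ := by gcongr

theorem chainWeight_le_of_permanent {b : ℝ} (hb : 0 ≤ b) (s : ℕ) (hs : 1 ≤ s)
    (hbs : 2 * b * s ≤ 1) (n : ℕ) :
    chainWeight (Real.exp (-b)) s n ≤ s.factorial * s.choose n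
        * Real.exp (-(b * (meanSlope s * n + ((s : ℝ) ^ 2 - 1) / 3)))
        * Real.exp (4 * b ^ 2 * s ^ 3) := by
  induction s, hs using Nat.le_induction generalizing n with
  | base =>
    rcases n with _ | _ | n
    · simp [chainWeight, hb]
    · simp [chainWeight, meanSlope]; norm_num
      exact le_mul_of_one_le_right (by positivity) (Real.one_le_exp (by positivity))
    · simp only [chainWeight]; simp [Nat.choose_eq_zero_of_lt]
  | succ s hs ih =>
    push_cast at hbs
    have ih := fun n => ih (by nlinarith) n
    obtain ⟨w₁, w₂, w₃, p1, p2, p3, e1, e2, e3, hW, hm⟩ := step_weights s n hs b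
    have J : w₁ * Real.exp (-(b * (n + 1) + b * (meanSlope s * (n + 1) + ((s : ℝ) ^ 2 - 1) / 3)))
        + w₂ * Real.exp (-(b * n + b * (meanSlope s * n + ((s : ℝ) ^ 2 - 1) / 3)))
        + w₃ * Real.exp (-(b * (n - 1) + b * (meanSlope s * (n - 1) + ((s : ℝ) ^ 2 - 1) / 3)))
        ≤ (s + 1) * (s + 1).choose n * Real.exp
          (-(b * (meanSlope (s + 1) * n + (((s : ℝ) + 1) ^ 2 - 1) / 3) - b * n))
          * Real.exp ((2 * b * (s + 1)) ^ 2) := by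
      rcases le_or_gt n (s + 1) with h | h
      · have hs' : (1 : ℝ) ≤ s := by exact_mod_cast hs
        have hn : (n : ℝ) ≤ s + 1 := by exact_mod_cast h
        have hslope : 1 + meanSlope s ≤ s + 1 := by
          unfold meanSlope
          rw [← le_sub_iff_add_le', div_le_iff₀ (by positivity)]
          nlinarith
        have hslope0 : 0 ≤ 1 + meanSlope s := by unfold meanSlope; positivity
        have hmean : b * (meanSlope (s + 1) * n + (((s : ℝ) + 1) ^ 2 - 1) / 3) - b * n
            = b * ((1 + meanSlope s) * (n + (s / (s + 1) - n * (2 * s + 1) / (s + 1) ^ 2))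
              + ((s : ℝ) ^ 2 - 1) / 3) := by
          unfold meanSlope; push_cast; field_simp; ring
        have hd1 : (s : ℝ) / (s + 1) - n * (2 * s + 1) / (s + 1) ^ 2 ≤ 1 := by
          have : (s : ℝ) / (s + 1) ≤ 1 := by rw [div_le_one (by positivity)]; linarith
          have : 0 ≤ n * (2 * s + 1) / ((s : ℝ) + 1) ^ 2 := by positivity
          linarith
        have hd2 : -1 ≤ (s : ℝ) / (s + 1) - n * (2 * s + 1) / (s + 1) ^ 2 := by
          have : n * (2 * s + 1) / ((s : ℝ) + 1) ^ 2 ≤ (s + 1) * (2 * s + 1) / ((s : ℝ) + 1) ^ 2 := by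
            gcongr
          have h2 : (s + 1) * (2 * s + 1) / ((s : ℝ) + 1) ^ 2 = s / (s + 1) + 1 := by
            field_simp; ring
          linarith
        set δ := (s : ℝ) / (s + 1) - n * (2 * s + 1) / (s + 1) ^ 2
        have hdev : ∀ x : ℝ, |x| ≤ 2 → |b * ((1 + meanSlope s) * x)| ≤ 2 * b * (s + 1) := by
          intro x hx
          rw [abs_mul, abs_mul, abs_of_nonneg hb, abs_of_nonneg hslope0]
          calc b * ((1 + meanSlope s) * |x|) ≤ b * ((s + 1) * 2) := by gcongr
            _ = _ := by ring
        refine sum_three_le_mul_exp p1 p2 p3 hW hm hbs ?_ ?_ ?_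
        · rw [hmean]
          convert hdev (1 - δ) (abs_le.2 ⟨by linarith, by linarith⟩) using 2
          ring
        · rw [hmean]
          convert hdev (-δ) (abs_le.2 ⟨by linarith, by linarith⟩) using 2
          ring
        · rw [hmean]
          convert hdev (-1 - δ) (abs_le.2 ⟨by linarith, by linarith⟩) using 2
          ring
      · have hc : ((s + 1).choose n : ℝ) = 0 := by rw [Nat.choose_eq_zero_of_lt h]; simp
        rw [hc, mul_zero] at hW
        have : w₁ = 0 := by linarith
        have : w₂ = 0 := by linarith
        have : w₃ = 0 := by linarith
        simp only [hc, ‹w₁ = 0›, ‹w₂ = 0›, ‹w₃ = 0›, zero_mul, mul_zero, add_zero, le_refl]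
    have hn3 : n * (Real.exp (-b) ^ (n - 1) * chainWeight (Real.exp (-b)) s (n - 1))
        ≤ (n : ℝ) * ((s.factorial * s.choose (n - 1)) * Real.exp (-(b * (n - 1)
          + b * (meanSlope s * (n - 1) + ((s : ℝ) ^ 2 - 1) / 3))) * Real.exp (4 * b ^ 2 * s ^ 3)) := by
      rcases n with _ | n
      · simp
      · refine mul_le_mul_of_nonneg_left ?_ (by positivity)
        have := ih n
        have h' := exp_pow_mul b n (b * (meanSlope s * n + ((s : ℝ) ^ 2 - 1) / 3))
        simp only [Nat.add_sub_cancel]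
        push_cast
        rw [show (n : ℝ) + 1 - 1 = n by ring, ← h']
        calc _ ≤ Real.exp (-b) ^ n * (s.factorial * s.choose n *
              Real.exp (-(b * (meanSlope s * n + ((s : ℝ) ^ 2 - 1) / 3)))
              * Real.exp (4 * b ^ 2 * s ^ 3)) := by gcongr
          _ = _ := by ring
    have hn1 := ih (n + 1)
    have hn2 := ih n
    have h1' := exp_pow_mul b (n + 1) (b * (meanSlope s * ((n + 1 : ℕ) : ℝ) + ((s : ℝ) ^ 2 - 1) / 3))
    have h2' := exp_pow_mul b n (b * (meanSlope s * n + ((s : ℝ) ^ 2 - 1) / 3))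
    have h0' := exp_pow_mul b n (b * (meanSlope (s + 1) * n + (((s : ℝ) + 1) ^ 2 - 1) / 3) - b * n)
    push_cast at h1' hn1
    simp only [chainWeight]
    calc _ ≤ Real.exp (-b) ^ n * ((n + 1) * (Real.exp (-b) ^ (n + 1) * (s.factorial *
            s.choose (n + 1) * Real.exp
              (-(b * (meanSlope s * (n + 1) + ((s : ℝ) ^ 2 - 1) / 3)))
              * Real.exp (4 * b ^ 2 * s ^ 3)))
          + (2 * n + 1) * (Real.exp (-b) ^ n * (s.factorial * s.choose n *
            Real.exp (-(b * (meanSlope s * n + ((s : ℝ) ^ 2 - 1) / 3)))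
              * Real.exp (4 * b ^ 2 * s ^ 3)))
          + n * ((s.factorial * s.choose (n - 1)) * Real.exp (-(b * (n - 1)
          + b * (meanSlope s * (n - 1) + ((s : ℝ) ^ 2 - 1) / 3)))
              * Real.exp (4 * b ^ 2 * s ^ 3))) := by gcongr
      _ = Real.exp (-b) ^ n * (s.factorial * (w₁ * Real.exp (-(b * (n + 1)
            + b * (meanSlope s * (n + 1) + ((s : ℝ) ^ 2 - 1) / 3)))
        + w₂ * Real.exp (-(b * n + b * (meanSlope s * n + ((s : ℝ) ^ 2 - 1) / 3)))
        + w₃ * Real.exp (-(b * (n - 1) + b * (meanSlope s * (n - 1) + ((s : ℝ) ^ 2 - 1) / 3)))))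
          * Real.exp (4 * b ^ 2 * s ^ 3) := by
          rw [← h1', ← h2', e1, e2, e3]; ring
      _ ≤ Real.exp (-b) ^ n * (s.factorial * ((s + 1) * (s + 1).choose n * Real.exp
          (-(b * (meanSlope (s + 1) * n + (((s : ℝ) + 1) ^ 2 - 1) / 3) - b * n))
          * Real.exp ((2 * b * (s + 1)) ^ 2))) * Real.exp (4 * b ^ 2 * s ^ 3) := by gcongr
      _ = ((s + 1).factorial * (s + 1).choose n * Real.exp
            (-(b * (meanSlope (s + 1) * n + (((s + 1 : ℕ) : ℝ) ^ 2 - 1) / 3))))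
            * Real.exp ((2 * b * (s + 1)) ^ 2 + 4 * b ^ 2 * s ^ 3) := by
          rw [show b * (meanSlope (s + 1) * n + (((s + 1 : ℕ) : ℝ) ^ 2 - 1) / 3)
            = b * n + (b * (meanSlope (s + 1) * n + (((s : ℝ) + 1) ^ 2 - 1) / 3) - b * n) by
            push_cast; ring, ← h0', Nat.factorial_succ, Real.exp_add]
          push_cast; ring
      _ ≤ _ := by
          gcongr
          push_cast
          have : (0 : ℝ) ≤ s := by positivity
          nlinarith [mul_nonneg (sq_nonneg b) this, mul_nonneg (sq_nonneg b) (sq_nonneg (s : ℝ))]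

section LowerBound

theorem exp_neg_pow (b : ℝ) (n : ℕ) : Real.exp (-b) ^ n = Real.exp (-(b * n)) := by
  rw [← Real.exp_nat_mul]; ring_nf

variable {b : ℝ}

/-- Climbing from height zero to height `n`. -/
theorem chainWeight_diag_ge (b : ℝ) (n : ℕ) :
    n.factorial * Real.exp (-(b * n ^ 2)) ≤ chainWeight (Real.exp (-b)) n n := by
  induction n with
  | zero => simp [chainWeight]
  | succ n ih =>
    have h0 := fun N k => chainWeight_nonneg (Real.exp_pos (-b)).le N k
    have h1 := h0 n (n + 1 + 1)
    have h2 := h0 n (n + 1)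
    simp only [chainWeight, Nat.add_sub_cancel]
    calc _ = Real.exp (-b) ^ (n + 1) * (((n + 1 : ℕ) : ℝ) * (Real.exp (-b) ^ n *
          (n.factorial * Real.exp (-(b * n ^ 2))))) := by
          rw [exp_neg_pow, exp_neg_pow, Nat.factorial_succ]
          have : Real.exp (-(b * ((n + 1 : ℕ) : ℝ) ^ 2)) = Real.exp (-(b * ((n + 1 : ℕ) : ℝ)))
            * Real.exp (-(b * n)) * Real.exp (-(b * (n : ℝ) ^ 2)) := by
            rw [← Real.exp_add, ← Real.exp_add]; push_cast; ring_nf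
          rw [this]; push_cast; ring
      _ ≤ Real.exp (-b) ^ (n + 1) * (((n + 1 : ℕ) : ℝ) * (Real.exp (-b) ^ n *
          chainWeight (Real.exp (-b)) n n)) := by gcongr
      _ ≤ _ := by
          gcongr
          have : 0 ≤ (((n + 1 : ℕ) : ℝ) + 1) * (Real.exp (-b) ^ (n + 1 + 1)
            * chainWeight (Real.exp (-b)) n (n + 1 + 1)) := by positivity
          have : 0 ≤ (2 * ((n + 1 : ℕ) : ℝ) + 1) * (Real.exp (-b) ^ (n + 1)
            * chainWeight (Real.exp (-b)) n (n + 1)) := by positivity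
          linarith

/-- Staying at height `n`. -/
theorem chainWeight_stay_ge (N n j : ℕ) :
    ((2 * n + 1) * Real.exp (-(2 * b * n))) ^ j * chainWeight (Real.exp (-b)) N n
      ≤ chainWeight (Real.exp (-b)) (N + j) n := by
  induction j with
  | zero => simp
  | succ j ih =>
    have h0 := fun N k => chainWeight_nonneg (Real.exp_pos (-b)).le N k
    have h1 := h0 (N + j) (n + 1)
    have h2 := h0 (N + j) (n - 1)
    have h3 := h0 N n
    rw [← add_assoc]
    simp only [chainWeight]
    calc _ = Real.exp (-b) ^ n * ((2 * n + 1) * (Real.exp (-b) ^ n *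
          (((2 * n + 1) * Real.exp (-(2 * b * n))) ^ j * chainWeight (Real.exp (-b)) N n))) := by
          have : Real.exp (-(2 * b * n)) = Real.exp (-b) ^ n * Real.exp (-b) ^ n := by
            rw [exp_neg_pow, ← Real.exp_add]; ring_nf
          rw [pow_succ, this]; ring
      _ ≤ Real.exp (-b) ^ n * ((2 * n + 1) * (Real.exp (-b) ^ n *
          chainWeight (Real.exp (-b)) (N + j) n)) := by gcongr
      _ ≤ _ := by
          gcongr
          have : 0 ≤ ((n : ℝ) + 1) * (Real.exp (-b) ^ (n + 1)
            * chainWeight (Real.exp (-b)) (N + j) (n + 1)) := by positivity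
          have : 0 ≤ (n : ℝ) * (Real.exp (-b) ^ (n - 1)
            * chainWeight (Real.exp (-b)) (N + j) (n - 1)) := by positivity
          linarith

/-- Descending from height `n` to height zero. -/
theorem chainWeight_descend_ge (b : ℝ) (N n : ℕ) :
    n.factorial * Real.exp (-(b * n ^ 2)) * chainWeight (Real.exp (-b)) N n
      ≤ chainWeight (Real.exp (-b)) (N + n) 0 := by
  induction n generalizing N with
  | zero => simp
  | succ n ih =>
    have h0 := fun N k => chainWeight_nonneg (Real.exp_pos (-b)).le N k
    have h1 := h0 N n
    have h2 := h0 N (n - 1)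
    have h3 := h0 N (n + 1)
    have h := ih (N + 1)
    rw [show N + (n + 1) = N + 1 + n by ring]
    refine le_trans ?_ h
    simp only [chainWeight]
    calc _ = n.factorial * Real.exp (-(b * n ^ 2)) * (Real.exp (-b) ^ n *
          ((n + 1) * (Real.exp (-b) ^ (n + 1) * chainWeight (Real.exp (-b)) N (n + 1)))) := by
          rw [exp_neg_pow, exp_neg_pow, Nat.factorial_succ]
          have : Real.exp (-(b * ((n + 1 : ℕ) : ℝ) ^ 2)) = Real.exp (-(b * ((n + 1 : ℕ) : ℝ)))
            * Real.exp (-(b * n)) * Real.exp (-(b * (n : ℝ) ^ 2)) := by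
            rw [← Real.exp_add, ← Real.exp_add]; push_cast; ring_nf
          rw [this]; push_cast; ring
      _ ≤ _ := by
          gcongr
          have : 0 ≤ (2 * (n : ℝ) + 1) * (Real.exp (-b) ^ n
            * chainWeight (Real.exp (-b)) N n) := by positivity
          have : 0 ≤ (n : ℝ) * (Real.exp (-b) ^ (n - 1)
            * chainWeight (Real.exp (-b)) N (n - 1)) := by positivity
          linarith

/-- The three coefficients at the heights of a window are at least those of a lazy random walk,
for which the sine function is an eigenvector. -/
theorem chainWeight_window_ge (hb : 0 ≤ b) {k ε : ℝ} (hk : 0 ≤ k) (hε : 0 ≤ ε) {a M K : ℕ}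
    (ha : 1 ≤ a) (hM : 2 ≤ M)
    (hG : ∀ n : ℕ, a ≤ n → n ≤ a + M → k ≤ n * Real.exp (-(2 * b * n)))
    (hK : ∀ n : ℕ, a ≤ n → n ≤ a + M → ε ≤ chainWeight (Real.exp (-b)) K n)
    (T : ℕ) (j : ℕ) (hj : j ≤ M) :
    ε * (2 * k * (1 + Real.cos (Real.pi / M))) ^ T * Real.sin (Real.pi * j / M)
      ≤ chainWeight (Real.exp (-b)) (K + T) (a + j) := by
  have hM0 : (0 : ℝ) < M := by exact_mod_cast (by omega : 0 < M)
  have h0 := fun N k => chainWeight_nonneg (Real.exp_pos (-b)).le N k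
  have hsin : ∀ j : ℕ, j ≤ M → 0 ≤ Real.sin (Real.pi * j / M) := fun j hj => by
    apply Real.sin_nonneg_of_nonneg_of_le_pi (by positivity)
    rw [div_le_iff₀ hM0]
    gcongr
  have hcos : 0 ≤ 1 + Real.cos (Real.pi / M) := by linarith [Real.neg_one_le_cos (Real.pi / M)]
  induction T generalizing j with
  | zero =>
    have := hK (a + j) (by omega) (by omega)
    calc _ ≤ ε * 1 := by
          rw [pow_zero, mul_one]
          exact mul_le_of_le_one_right hε (Real.sin_le_one _)
      _ ≤ _ := by simpa using this
  | succ T ih =>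
    rcases Nat.eq_zero_or_pos j with rfl | hj0
    · simpa using h0 _ _
    rcases hj.eq_or_lt with rfl | hjM
    · rw [mul_div_cancel_right₀ _ hM0.ne', Real.sin_pi, mul_zero]
      exact h0 _ _
    obtain ⟨i, rfl⟩ : ∃ i, j = i + 1 := ⟨j - 1, by omega⟩
    set l := ε * (2 * k * (1 + Real.cos (Real.pi / M))) ^ T with hl
    have hl0 : 0 ≤ l := by positivity
    have i1 := ih (i + 2) (by omega)
    have i2 := ih (i + 1) (by omega)
    have i3 := ih i (by omega)
    have s1 := hsin (i + 2) (by omega)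
    have s2 := hsin (i + 1) (by omega)
    have s3 := hsin i (by omega)
    have g1 := hG (a + i + 2) (by omega) (by omega)
    have g2 := hG (a + i + 1) (by omega) (by omega)
    rw [show a + (i + 2) = a + i + 2 by ring] at i1
    rw [show a + (i + 1) = a + i + 1 by ring] at i2
    have c1 : k ≤ Real.exp (-b) ^ (a + i + 1)
        * ((((a + i + 1 : ℕ) : ℝ) + 1) * Real.exp (-b) ^ (a + i + 1 + 1)) := by
      refine g1.trans ?_
      rw [exp_neg_pow, exp_neg_pow, mul_left_comm, ← Real.exp_add]
      push_cast
      have : (a : ℝ) + i + 1 + 1 = a + i + 2 := by ring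
      rw [this]
      gcongr
      nlinarith
    have c2 : 2 * k ≤ Real.exp (-b) ^ (a + i + 1)
        * ((2 * ((a + i + 1 : ℕ) : ℝ) + 1) * Real.exp (-b) ^ (a + i + 1)) := by
      rw [exp_neg_pow, mul_left_comm, ← Real.exp_add]
      have : -(b * ((a + i + 1 : ℕ) : ℝ)) + -(b * ((a + i + 1 : ℕ) : ℝ))
        = -(2 * b * ((a + i + 1 : ℕ) : ℝ)) := by ring
      rw [this]
      nlinarith [Real.exp_pos (-(2 * b * ((a + i + 1 : ℕ) : ℝ)))]
    have c3 : k ≤ Real.exp (-b) ^ (a + i + 1)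
        * (((a + i + 1 : ℕ) : ℝ) * Real.exp (-b) ^ (a + i)) := by
      refine g2.trans ?_
      rw [exp_neg_pow, exp_neg_pow, mul_left_comm, ← Real.exp_add]
      gcongr
      push_cast
      nlinarith
    have htrig : Real.sin (Real.pi * ((i + 2 : ℕ) : ℝ) / M) + Real.sin (Real.pi * (i : ℝ) / M)
        = 2 * Real.cos (Real.pi / M) * Real.sin (Real.pi * ((i + 1 : ℕ) : ℝ) / M) := by
      have e1 : Real.pi * ((i + 2 : ℕ) : ℝ) / M
          = Real.pi * ((i + 1 : ℕ) : ℝ) / M + Real.pi / M := by push_cast; field_simp; ring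
      have e2 : Real.pi * (i : ℝ) / M
          = Real.pi * ((i + 1 : ℕ) : ℝ) / M - Real.pi / M := by push_cast; field_simp; ring
      rw [e1, e2, Real.sin_add, Real.sin_sub]; ring
    rw [show a + (i + 1) = a + i + 1 by ring, ← add_assoc K T 1]
    simp only [chainWeight, Nat.add_sub_cancel]
    have q1 := h0 (K + T) (a + i + 2)
    have q2 := h0 (K + T) (a + i + 1)
    have q3 := h0 (K + T) (a + i)
    calc _ = k * (l * Real.sin (Real.pi * ((i + 2 : ℕ) : ℝ) / M))
          + 2 * k * (l * Real.sin (Real.pi * ((i + 1 : ℕ) : ℝ) / M))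
          + k * (l * Real.sin (Real.pi * (i : ℝ) / M)) := by
          rw [pow_succ]; linear_combination (-k * l) * htrig
      _ ≤ k * chainWeight (Real.exp (-b)) (K + T) (a + i + 2)
          + 2 * k * chainWeight (Real.exp (-b)) (K + T) (a + i + 1)
          + k * chainWeight (Real.exp (-b)) (K + T) (a + i) := by gcongr
      _ ≤ (Real.exp (-b) ^ (a + i + 1)
          * ((((a + i + 1 : ℕ) : ℝ) + 1) * Real.exp (-b) ^ (a + i + 1 + 1)))
            * chainWeight (Real.exp (-b)) (K + T) (a + i + 2)
          + (Real.exp (-b) ^ (a + i + 1)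
          * ((2 * ((a + i + 1 : ℕ) : ℝ) + 1) * Real.exp (-b) ^ (a + i + 1)))
            * chainWeight (Real.exp (-b)) (K + T) (a + i + 1)
          + (Real.exp (-b) ^ (a + i + 1) * (((a + i + 1 : ℕ) : ℝ) * Real.exp (-b) ^ (a + i)))
            * chainWeight (Real.exp (-b)) (K + T) (a + i) := by gcongr
      _ = _ := by ring

theorem factorial_mul_exp_ge (hb : 0 < b) {n : ℕ} (h1 : 1 ≤ 2 * b * n) (h2 : b * n ≤ 1) :
    (Real.exp (-3) / b) ^ n ≤ n.factorial * Real.exp (-(b * n ^ 2)) := by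
  have hf : (n : ℝ) ^ n * Real.exp (-n) ≤ n.factorial := by
    have h := Real.pow_div_factorial_le_exp (n : ℝ) (by positivity) n
    rw [div_le_iff₀ (by positivity)] at h
    calc (n : ℝ) ^ n * Real.exp (-n) ≤ Real.exp n * n.factorial * Real.exp (-n) := by gcongr
      _ = n.factorial * (Real.exp n * Real.exp (-n)) := by ring
      _ = n.factorial := by rw [← Real.exp_add]; simp
  have he : Real.exp (-1) ≤ 1 / 2 := by
    rw [Real.exp_neg, inv_eq_one_div]
    apply one_div_le_one_div_of_le (by norm_num)
    linarith [Real.add_one_le_exp 1]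
  calc (Real.exp (-3) / b) ^ n ≤ (n * Real.exp (-2)) ^ n := by
        gcongr
        rw [div_le_iff₀ hb, show (-3 : ℝ) = -1 + -2 by norm_num, Real.exp_add]
        have := Real.exp_pos (-2)
        nlinarith
    _ = (n : ℝ) ^ n * Real.exp (-n) * Real.exp (-n) := by
        rw [mul_pow, ← Real.exp_nat_mul, mul_assoc, ← Real.exp_add]; ring_nf
    _ ≤ n.factorial * Real.exp (-(b * n ^ 2)) := by
        gcongr
        nlinarith [(Nat.cast_nonneg n : (0 : ℝ) ≤ n)]

theorem one_sub_ge_exp {x : ℝ} (h0 : 0 ≤ x) (h : x ≤ 1 / 2) : Real.exp (-(2 * x)) ≤ 1 - x := by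
  rw [Real.exp_neg, inv_eq_one_div, div_le_iff₀ (Real.exp_pos _)]
  nlinarith [Real.add_one_le_exp (2 * x)]

set_option maxHeartbeats 1000000 in
theorem chainWeight_zero_ge (hb : 0 < b) (hb1 : b ≤ 1 / 100) {N : ℕ} (hN : 2 ≤ N * b) :
    (2 / b * Real.exp (-1)) ^ N * Real.exp (-(24 * (b * N + 1 / b)))
      ≤ chainWeight (Real.exp (-b)) N 0 := by
  obtain ⟨s, hs0, rfl⟩ : ∃ s : ℝ, 0 < s ∧ b = s ^ 2 :=
    ⟨Real.sqrt b, Real.sqrt_pos.2 hb, (Real.sq_sqrt hb.le).symm⟩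
  have hs1 : s ≤ 1 / 10 := by nlinarith
  set a := ⌈1 / (2 * s ^ 2)⌉₊ with ha
  set M := ⌈1 / s⌉₊ with hM
  have ha1 : 1 / (2 * s ^ 2) ≤ a := Nat.le_ceil _
  have ha2 : (a : ℝ) ≤ 1 / (2 * s ^ 2) + 1 := (Nat.ceil_lt_add_one (by positivity)).le
  have hM1 : 1 / s ≤ M := Nat.le_ceil _
  have hM2 : (M : ℝ) ≤ 1 / s + 1 := (Nat.ceil_lt_add_one (by positivity)).le
  have ha1' : 1 ≤ 2 * s ^ 2 * a := by
    rw [div_le_iff₀ (by positivity)] at ha1; linarith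
  have hM1' : 1 ≤ s * M := by
    rw [div_le_iff₀ (by positivity)] at hM1; linarith
  have hsM : s * M ≤ 1 + s := by
    calc s * M ≤ s * (1 / s + 1) := by gcongr
      _ = 1 + s := by field_simp
  have haM : 2 * s ^ 2 * (a + M) ≤ 1 + 3 * s := by
    have h1 : 2 * s ^ 2 * a ≤ 1 + 2 * s ^ 2 := by
      calc 2 * s ^ 2 * a ≤ 2 * s ^ 2 * (1 / (2 * s ^ 2) + 1) := by gcongr
        _ = 1 + 2 * s ^ 2 := by field_simp
    nlinarith
  have hMten : (10 : ℝ) ≤ M := by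
    by_contra! h
    nlinarith
  have hM2' : 2 ≤ M := by
    have : (2 : ℝ) ≤ M := by linarith
    exact_mod_cast this
  have ha1n : 1 ≤ a := Nat.one_le_iff_ne_zero.2 fun h => by
    rw [h] at ha1'; norm_num at ha1'
  have hwin : ∀ n : ℕ, a ≤ n → n ≤ a + M →
      1 ≤ 2 * s ^ 2 * n ∧ 2 * s ^ 2 * n ≤ 1 + 3 * s := by
    intro n h1 h2
    have h1' : (a : ℝ) ≤ n := by exact_mod_cast h1
    have h2' : (n : ℝ) ≤ a + M := by exact_mod_cast h2
    exact ⟨ha1'.trans (by gcongr), le_trans (by gcongr) haM⟩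
  set k := (1 - 9 * s ^ 2) * Real.exp (-1) / (2 * s ^ 2) with hk
  have hk0 : 0 ≤ k := by
    have : 0 ≤ 1 - 9 * s ^ 2 := by linarith
    positivity
  have hG : ∀ n : ℕ, a ≤ n → n ≤ a + M → k ≤ n * Real.exp (-(2 * s ^ 2 * n)) := by
    intro n h1 h2
    obtain ⟨t1, t2⟩ := hwin n h1 h2
    rw [hk, div_le_iff₀ (by positivity)]
    set t := 2 * s ^ 2 * (n : ℝ) with ht
    have he : Real.exp (-t) = Real.exp (-(t - 1)) * Real.exp (-1) := by
      rw [← Real.exp_add]; ring_nf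
    have h3 : 1 - (t - 1) ≤ Real.exp (-(t - 1)) := by
      linarith [Real.add_one_le_exp (-(t - 1))]
    have h4 : (1 - 9 * s ^ 2) ≤ t * Real.exp (-(t - 1)) := by
      calc 1 - 9 * s ^ 2 ≤ t * (1 - (t - 1)) := by nlinarith
        _ ≤ _ := by gcongr
    calc (1 - 9 * s ^ 2) * Real.exp (-1) ≤ t * Real.exp (-(t - 1)) * Real.exp (-1) := by gcongr
      _ = n * Real.exp (-t) * (2 * s ^ 2) := by rw [he, ht]; ring
  set K := a + M with hKdef
  set ε := (Real.exp (-3) / s ^ 2) ^ K with hε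
  have hK : ∀ n : ℕ, a ≤ n → n ≤ a + M → ε ≤ chainWeight (Real.exp (-s ^ 2)) K n := by
    intro n h1 h2
    obtain ⟨t1, t2⟩ := hwin n h1 h2
    have h3 := factorial_mul_exp_ge hb t1 (by linarith)
    have h4 := chainWeight_diag_ge (s ^ 2) n
    have h5 := chainWeight_stay_ge (b := s ^ 2) n n (K - n)
    rw [Nat.add_sub_of_le h2] at h5
    refine le_trans ?_ h5
    have h6 : Real.exp (-3) / s ^ 2 ≤ (2 * n + 1) * Real.exp (-(2 * s ^ 2 * n)) := by
      have e1 : Real.exp (-3) ≤ Real.exp (-(2 * s ^ 2 * n)) := Real.exp_le_exp.2 (by linarith)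
      rw [div_eq_inv_mul]
      have e2 : (s ^ 2)⁻¹ ≤ 2 * n + 1 := by
        rw [inv_le_iff_one_le_mul₀ hb]; nlinarith
      gcongr
    calc ε = (Real.exp (-3) / s ^ 2) ^ (K - n) * (Real.exp (-3) / s ^ 2) ^ n := by
          rw [hε, ← pow_add, Nat.sub_add_cancel h2]
      _ ≤ _ := by
          gcongr
          exact h3.trans h4
  have haMR : s ^ 2 * (a + M) ≤ 1 := by nlinarith
  have hNp : a + 1 + K ≤ N := by
    have h1 : ((a + 1 + K : ℕ) : ℝ) ≤ N := by
      rw [hKdef]; push_cast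
      by_contra! h
      nlinarith
    exact_mod_cast h1
  obtain ⟨T, hT⟩ : ∃ T, N = K + T + (a + 1) := ⟨N - (a + 1 + K), by omega⟩
  have hW := chainWeight_window_ge hb.le hk0 (by positivity : 0 ≤ ε) ha1n hM2' hG hK T 1 (by omega)
  have hD := chainWeight_descend_ge (s ^ 2) (K + T) (a + 1)
  obtain ⟨t1, t2⟩ := hwin (a + 1) (by omega) (by omega)
  have hF := factorial_mul_exp_ge hb t1 (by linarith)
  set Λ := 2 / s ^ 2 * Real.exp (-1) with hΛ
  have hΛ0 : 0 < Λ := by positivity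
  have hl : Λ * Real.exp (-(24 * s ^ 2)) ≤ 2 * k * (1 + Real.cos (Real.pi / M)) := by
    have hcos := Real.one_sub_sq_div_two_le_cos (x := Real.pi / M)
    have hpi : (Real.pi / M) ^ 2 ≤ 10 * s ^ 2 := by
      have h1 : Real.pi / M ≤ Real.pi * s := by
        rw [div_le_iff₀ (by linarith)]
        nlinarith [Real.pi_pos]
      have h2 : Real.pi ^ 2 ≤ 10 := by nlinarith [Real.pi_lt_d2, Real.pi_pos]
      calc (Real.pi / M) ^ 2 ≤ (Real.pi * s) ^ 2 := by gcongr
        _ = Real.pi ^ 2 * s ^ 2 := by ring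
        _ ≤ _ := by gcongr
    have h1 := one_sub_ge_exp (x := 12 * s ^ 2) (by positivity) (by linarith)
    calc Λ * Real.exp (-(24 * s ^ 2)) ≤ Λ * ((1 - 9 * s ^ 2) * (1 - 5 / 2 * s ^ 2)) := by
          gcongr
          rw [show 24 * s ^ 2 = 2 * (12 * s ^ 2) by ring]
          nlinarith
      _ = 2 * k * (2 - 5 * s ^ 2) := by rw [hΛ, hk]; field_simp
      _ ≤ _ := by gcongr; linarith
  have hsin : Real.exp (-(1 / s ^ 2)) ≤ Real.sin (Real.pi * ((1 : ℕ) : ℝ) / M) := by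
    have hM0 : (0 : ℝ) < M := by linarith
    have h1 : Real.pi * ((1 : ℕ) : ℝ) / M ≤ Real.pi / 2 := by
      push_cast; rw [mul_one]; gcongr; linarith
    have h2 := Real.mul_le_sin (x := Real.pi * ((1 : ℕ) : ℝ) / M) (by positivity) h1
    refine le_trans ?_ h2
    have h3 : 2 / Real.pi * (Real.pi * ((1 : ℕ) : ℝ) / M) = 2 / M := by
      push_cast; field_simp
    have h4 : s ^ 2 ≤ 2 / M := by
      rw [le_div_iff₀ hM0]; nlinarith
    have h5 : Real.exp (-(1 / s ^ 2)) ≤ s ^ 2 := by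
      rw [Real.exp_neg, inv_le_iff_one_le_mul₀ (Real.exp_pos _)]
      have := Real.add_one_le_exp (1 / s ^ 2)
      calc (1 : ℝ) = s ^ 2 * (1 / s ^ 2) := by field_simp
        _ ≤ _ := by gcongr; linarith
    linarith
  have hstep : Λ * Real.exp (-3) ≤ Real.exp (-3) / s ^ 2 := by
    have he : Real.exp (-1) ≤ 1 / 2 := by
      rw [Real.exp_neg, inv_eq_one_div]
      apply one_div_le_one_div_of_le (by norm_num)
      linarith [Real.add_one_le_exp 1]
    calc Λ * Real.exp (-3) ≤ 2 / s ^ 2 * (1 / 2) * Real.exp (-3) := by rw [hΛ]; gcongr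
      _ = _ := by field_simp
  have hexp : Real.exp (-(24 * (s ^ 2 * N + 1 / s ^ 2))) ≤ Real.exp (-3) ^ (a + 1)
      * (Real.exp (-3) ^ K * Real.exp (-(24 * s ^ 2)) ^ T * Real.exp (-(1 / s ^ 2))) := by
    simp only [← Real.exp_nat_mul, ← Real.exp_add]
    apply Real.exp_le_exp.2
    have h1 : (a : ℝ) + M ≤ 1 / s ^ 2 := by rw [le_div_iff₀ hb]; linarith
    have h2 : 0 ≤ s ^ 2 * ((K : ℝ) + (a + 1)) := by positivity
    have h3 : (N : ℝ) = K + T + (a + 1) := by exact_mod_cast hT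
    have h4 : (K : ℝ) = a + M := by exact_mod_cast hKdef
    rw [h3]
    push_cast
    nlinarith
  obtain ⟨ν, hν⟩ : ∃ ν, ν = 2 * k * (1 + Real.cos (Real.pi / M)) := ⟨_, rfl⟩
  rw [← hν] at hl hW
  have hν0 : 0 ≤ ν := le_trans (by positivity) hl
  have hε0 : 0 ≤ ε := by positivity
  have hsin0 := (Real.exp_pos _).le.trans hsin
  calc Λ ^ N * Real.exp (-(24 * (s ^ 2 * N + 1 / s ^ 2)))
      ≤ Λ ^ N * (Real.exp (-3) ^ (a + 1)
      * (Real.exp (-3) ^ K * Real.exp (-(24 * s ^ 2)) ^ T * Real.exp (-(1 / s ^ 2)))) := by gcongr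
    _ = (Λ * Real.exp (-3)) ^ (a + 1) * ((Λ * Real.exp (-3)) ^ K
        * (Λ * Real.exp (-(24 * s ^ 2))) ^ T * Real.exp (-(1 / s ^ 2))) := by
        rw [hT]; simp only [mul_pow, pow_add]; ring
    _ ≤ (Real.exp (-3) / s ^ 2) ^ (a + 1) * (ε * ν ^ T
        * Real.sin (Real.pi * ((1 : ℕ) : ℝ) / M)) := by rw [hε]; gcongr
    _ ≤ (a + 1).factorial * Real.exp (-(s ^ 2 * ((a + 1 : ℕ) : ℝ) ^ 2))
        * chainWeight (Real.exp (-s ^ 2)) (K + T) (a + 1) :=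
        mul_le_mul hF hW (by positivity) (by positivity)
    _ ≤ _ := by rw [hT]; exact hD

end LowerBound

section Growth

variable {E : Type*} [NormedAddCommGroup E]

/-- Continuous functions of at most polynomial growth. -/
def PolyGrowth (f : E → ℝ) : Prop :=
  Continuous f ∧ ∃ (C : ℝ) (m : ℕ), 0 ≤ C ∧ ∀ x, |f x| ≤ C * (1 + ‖x‖) ^ m

theorem PolyGrowth.const (c : ℝ) : PolyGrowth (fun _ : E => c) :=
  ⟨continuous_const, |c|, 0, abs_nonneg c, by simp⟩

theorem PolyGrowth.add {f g : E → ℝ} (hf : PolyGrowth f) (hg : PolyGrowth g) :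
    PolyGrowth (fun x => f x + g x) := by
  obtain ⟨cf, C, m, hC, h⟩ := hf
  obtain ⟨cg, D, n, hD, k⟩ := hg
  refine ⟨cf.add cg, C + D, m + n, by positivity, fun x => ?_⟩
  have h1 : (1 : ℝ) ≤ 1 + ‖x‖ := by linarith [norm_nonneg x]
  calc _ ≤ |f x| + |g x| := abs_add_le _ _
    _ ≤ C * (1 + ‖x‖) ^ m + D * (1 + ‖x‖) ^ n := add_le_add (h x) (k x)
    _ ≤ C * (1 + ‖x‖) ^ (m + n) + D * (1 + ‖x‖) ^ (m + n) := by
      gcongr <;> first | exact h1 | omega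
    _ = _ := by ring

theorem PolyGrowth.mul {f g : E → ℝ} (hf : PolyGrowth f) (hg : PolyGrowth g) :
    PolyGrowth (fun x => f x * g x) := by
  obtain ⟨cf, C, m, hC, h⟩ := hf
  obtain ⟨cg, D, n, hD, k⟩ := hg
  refine ⟨cf.mul cg, C * D, m + n, by positivity, fun x => ?_⟩
  rw [abs_mul]
  calc _ ≤ (C * (1 + ‖x‖) ^ m) * (D * (1 + ‖x‖) ^ n) :=
        mul_le_mul (h x) (k x) (abs_nonneg _) (by positivity)
    _ = _ := by ring

theorem PolyGrowth.pow {f : E → ℝ} (hf : PolyGrowth f) (n : ℕ) :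
    PolyGrowth (fun x => f x ^ n) := by
  induction n with
  | zero => simpa using PolyGrowth.const 1
  | succ n ih => simpa only [pow_succ] using ih.mul hf

theorem PolyGrowth.sum {ι : Type*} (s : Finset ι) {f : ι → E → ℝ}
    (hf : ∀ i ∈ s, PolyGrowth (f i)) : PolyGrowth (fun x => ∑ i ∈ s, f i x) := by
  classical
  induction s using Finset.induction_on with
  | empty => simpa using PolyGrowth.const 0
  | insert a s ha ih =>
    simp only [Finset.sum_insert ha]
    exact (hf a (by simp)).add (ih fun i hi => hf i (by simp [hi]))

theorem PolyGrowth.prod {ι : Type*} (s : Finset ι) {f : ι → E → ℝ}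
    (hf : ∀ i ∈ s, PolyGrowth (f i)) : PolyGrowth (fun x => ∏ i ∈ s, f i x) := by
  classical
  induction s using Finset.induction_on with
  | empty => simpa using PolyGrowth.const 1
  | insert a s ha ih =>
    simp only [Finset.prod_insert ha]
    exact (hf a (by simp)).mul (ih fun i hi => hf i (by simp [hi]))

theorem PolyGrowth.polynomial_eval {f : E → ℝ} (hf : PolyGrowth f) (p : Polynomial ℝ) :
    PolyGrowth (fun x => p.eval (f x)) := by
  simp only [Polynomial.eval_eq_sum_range]
  exact PolyGrowth.sum _ fun i _ => (PolyGrowth.const _).mul (hf.pow i)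

theorem PolyGrowth.of_norm_le {f : E → ℝ} (hf : Continuous f) (h : ∀ x, |f x| ≤ ‖x‖) :
    PolyGrowth f :=
  ⟨hf, 1, 1, zero_le_one, fun x => by linarith [h x]⟩

theorem PolyGrowth.integrable [NormedSpace ℝ E] [MeasurableSpace E] [BorelSpace E]
    [CompleteSpace E] [SecondCountableTopology E] {f : E → ℝ} (hf : PolyGrowth f)
    (μ : Measure E) [IsGaussian μ] : Integrable f μ := by
  obtain ⟨cf, C, m, hC, h⟩ := hf
  have h0 : MemLp (fun x : E => ‖x‖) (m : ENNReal) μ :=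
    (IsGaussian.memLp_id μ m (ENNReal.natCast_ne_top m)).norm
  have hc : MemLp (fun _ : E => (1 : ℝ)) (m : ENNReal) μ := memLp_const 1
  have h1 : MemLp (fun x : E => 1 + ‖x‖) (m : ENNReal) μ := hc.add h0
  have h2 : Integrable (fun x : E => C * ‖1 + ‖x‖‖ ^ m) μ :=
    h1.integrable_norm_pow'.const_mul C
  refine h2.mono' cf.aestronglyMeasurable (Eventually.of_forall fun x => ?_)
  rw [Real.norm_eq_abs, Real.norm_eq_abs, abs_of_nonneg (by positivity : 0 ≤ 1 + ‖x‖)]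
  exact h x

theorem PolyGrowth.memLp_two [NormedSpace ℝ E] [MeasurableSpace E] [BorelSpace E]
    [CompleteSpace E] [SecondCountableTopology E] {f : E → ℝ} (hf : PolyGrowth f)
    (μ : Measure E) [IsGaussian μ] : MemLp f 2 μ :=
  (memLp_two_iff_integrable_sq hf.1.aestronglyMeasurable).2 ((hf.pow 2).integrable μ)

end Growth

/-- Gaussian integration by parts for polynomials. -/
theorem integral_mul_polynomial_gaussianReal (p : Polynomial ℝ) :
    ∫ w, w * p.eval w ∂gaussianReal 0 1 = ∫ w, (Polynomial.derivative p).eval w ∂gaussianReal 0 1 := by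
  have hid : PolyGrowth (fun w : ℝ => w) := PolyGrowth.of_norm_le continuous_id fun x => le_rfl
  have hint : ∀ f : ℝ → ℝ, PolyGrowth f →
      Integrable (fun x => gaussianPDFReal 0 1 x * f x) := fun f hf => by
    have := hf.integrable (gaussianReal 0 1)
    rw [gaussianReal_of_var_ne_zero _ one_ne_zero, integrable_withDensity_iff_integrable_smul'
      (measurable_gaussianPDF _ _) (ae_of_all _ fun _ => gaussianPDF_lt_top)] at this
    simpa using this
  have hderiv : ∀ x, HasDerivAt (gaussianPDFReal 0 1) (-x * gaussianPDFReal 0 1 x) x := fun x => by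
    have e : gaussianPDFReal 0 1
        = fun x => (Real.sqrt (2 * Real.pi * 1))⁻¹ * Real.exp (-(x - 0) ^ 2 / (2 * 1)) := by
      ext x; simp [gaussianPDFReal]
    rw [e]
    have h1 : HasDerivAt (fun x : ℝ => -(x - 0) ^ 2 / (2 * 1)) (-x) x := by
      have := (((hasDerivAt_id x).sub_const 0).pow 2).neg.div_const (2 * 1)
      refine this.congr_deriv ?_
      simp; ring
    refine (h1.exp.const_mul ((Real.sqrt (2 * Real.pi * 1))⁻¹)).congr_deriv ?_
    ring
  have key := integral_mul_deriv_eq_deriv_mul_of_integrable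
    (u := fun x => p.eval x) (v := gaussianPDFReal 0 1)
    (u' := fun x => (Polynomial.derivative p).eval x) (v' := fun x => -x * gaussianPDFReal 0 1 x)
    (fun x _ => p.hasDerivAt x) (fun x _ => hderiv x)
    (by
      have := hint _ ((hid.mul (hid.polynomial_eval p)).mul (PolyGrowth.const (-1)))
      refine this.congr (Eventually.of_forall fun x => ?_)
      simp; ring)
    (by
      have := hint _ (hid.polynomial_eval (Polynomial.derivative p))
      refine this.congr (Eventually.of_forall fun x => ?_)
      simp; ring)
    (by
      have := hint _ (hid.polynomial_eval p)
      refine this.congr (Eventually.of_forall fun x => ?_)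
      simp; ring)
  rw [integral_gaussianReal_eq_integral_smul one_ne_zero,
    integral_gaussianReal_eq_integral_smul one_ne_zero]
  simp only [smul_eq_mul]
  calc _ = -∫ x, p.eval x * (-x * gaussianPDFReal 0 1 x) := by
        rw [← integral_neg]; congr 1; ext x; ring
    _ = _ := by rw [key, neg_neg]; congr 1; ext x; ring

/-- The probabilists' Hermite polynomials over `ℝ`. -/
noncomputable def realHermite (n : ℕ) : Polynomial ℝ :=
  (Polynomial.hermite n).map (Int.castRingHom ℝ)

theorem realHermite_zero : realHermite 0 = 1 := by simp [realHermite]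

theorem realHermite_one : realHermite 1 = Polynomial.X := by simp [realHermite]

theorem realHermite_succ (n : ℕ) : realHermite (n + 1)
    = Polynomial.X * realHermite n - Polynomial.derivative (realHermite n) := by
  simp [realHermite, Polynomial.hermite_succ, Polynomial.derivative_map]

theorem derivative_realHermite_succ (n : ℕ) :
    Polynomial.derivative (realHermite (n + 1)) = ((n : Polynomial ℝ) + 1) * realHermite n := by
  induction n with
  | zero => simp [realHermite_one, realHermite_zero]
  | succ n ih =>
    rw [realHermite_succ (n + 1), Polynomial.derivative_sub, Polynomial.derivative_mul, ih]
    have h : Polynomial.derivative (((n : Polynomial ℝ) + 1) * realHermite n)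
        = ((n : Polynomial ℝ) + 1) * Polynomial.derivative (realHermite n) := by
      rw [Polynomial.derivative_mul]; simp
    rw [h, realHermite_succ n]
    simp only [Polynomial.derivative_X]
    push_cast
    ring

theorem realHermite_eval_add_two (n : ℕ) (x : ℝ) : (realHermite (n + 2)).eval x
    = x * (realHermite (n + 1)).eval x - (n + 1) * (realHermite n).eval x := by
  rw [realHermite_succ (n + 1), derivative_realHermite_succ]
  simp

/-- Mehler averaging of Hermite polynomials. -/
theorem integral_realHermite {r σ : ℝ} (h : r ^ 2 + σ ^ 2 = 1) (x : ℝ) (n : ℕ) :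
    ∫ w, (realHermite n).eval (r * x + σ * w) ∂gaussianReal 0 1
      = r ^ n * (realHermite n).eval x := by
  have hid : PolyGrowth (fun w : ℝ => w) := PolyGrowth.of_norm_le continuous_id fun x => le_rfl
  have hlin : PolyGrowth (fun w : ℝ => r * x + σ * w) :=
    (PolyGrowth.const _).add ((PolyGrowth.const _).mul hid)
  have hH : ∀ n, PolyGrowth (fun w : ℝ => (realHermite n).eval (r * x + σ * w)) :=
    fun n => hlin.polynomial_eval _
  have hlin0 : ∫ w, w ∂gaussianReal 0 1 = 0 := integral_id_gaussianReal
  induction n using Nat.strong_induction_on with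
  | _ n ih =>
  match n, ih with
  | 0, _ => simp [realHermite_zero]
  | 1, _ =>
    simp only [realHermite_one, Polynomial.eval_X, pow_one]
    rw [integral_add (integrable_const _) (((PolyGrowth.const σ).mul hid).integrable _),
      integral_const_mul σ, hlin0]
    simp
  | n + 2, ih =>
    have i0 := ih n (by omega)
    have i1 := ih (n + 1) (by omega)
    have hst : ∫ w, w * (realHermite (n + 1)).eval (r * x + σ * w) ∂gaussianReal 0 1
        = σ * ((n + 1) * (r ^ n * (realHermite n).eval x)) := by
      have := integral_mul_polynomial_gaussianReal
        ((realHermite (n + 1)).comp (Polynomial.C (r * x) + Polynomial.C σ * Polynomial.X))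
      simp only [Polynomial.eval_comp, Polynomial.eval_add, Polynomial.eval_C, Polynomial.eval_mul,
        Polynomial.eval_X, Polynomial.derivative_comp, derivative_realHermite_succ,
        Polynomial.derivative_add, Polynomial.derivative_C, Polynomial.derivative_mul,
        Polynomial.derivative_X, Polynomial.eval_natCast, Polynomial.eval_one,
        zero_mul, zero_add, mul_one] at this
      rw [this, integral_const_mul, integral_const_mul, i0]
    have e : ∀ w, (realHermite (n + 2)).eval (r * x + σ * w)
        = (r * x) * (realHermite (n + 1)).eval (r * x + σ * w)
          + σ * (w * (realHermite (n + 1)).eval (r * x + σ * w))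
          - (n + 1) * (realHermite n).eval (r * x + σ * w) := fun w => by
      rw [realHermite_eval_add_two]; ring
    have g1 := ((PolyGrowth.const (r * x)).mul (hH (n + 1)))
    have g2 := ((PolyGrowth.const σ).mul (hid.mul (hH (n + 1))))
    have g3 := ((PolyGrowth.const ((n : ℝ) + 1)).mul (hH n))
    simp only [e]
    rw [integral_sub ((g1.add g2).integrable _) (g3.integrable _),
      integral_add (g1.integrable _) (g2.integrable _), integral_const_mul, integral_const_mul,
      integral_const_mul, i0, i1, hst, realHermite_eval_add_two]
    linear_combination ((n : ℝ) + 1) * r ^ n * (realHermite n).eval x * h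

/-- Normalised Hermite polynomials of even degree. -/
noncomputable def evenHermite (i : ℕ) (x : ℝ) : ℝ :=
  (realHermite (2 * i)).eval x / (2 ^ i * i.factorial)

theorem sq_mul_evenHermite_zero (x : ℝ) :
    x ^ 2 / 2 * evenHermite 0 x = evenHermite 1 x + 1 / 2 * evenHermite 0 x := by
  simp [evenHermite, realHermite_eval_add_two 0, realHermite_zero, realHermite_one]
  ring

theorem sq_mul_evenHermite_succ (i : ℕ) (x : ℝ) :
    x ^ 2 / 2 * evenHermite (i + 1) x = (i + 2) * evenHermite (i + 2) x
      + (4 * i + 5) / 2 * evenHermite (i + 1) x + (2 * i + 1) / 2 * evenHermite i x := by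
  have a := realHermite_eval_add_two (2 * i + 2) x
  have b := realHermite_eval_add_two (2 * i + 1) x
  have c := realHermite_eval_add_two (2 * i) x
  have h1 : (realHermite (2 * i + 1)).eval x * x
      = (realHermite (2 * i + 2)).eval x + (2 * i + 1) * (realHermite (2 * i)).eval x := by
    push_cast at c; linarith
  have e1 : 2 * (i + 2) = 2 * i + 2 + 2 := by ring
  have e2 : 2 * (i + 1) = 2 * i + 2 := by ring
  have h4 : (realHermite (2 * i + 2 + 2)).eval x = (x ^ 2 - (4 * i + 5))
      * (realHermite (2 * i + 2)).eval x
      - (2 * i + 2) * (2 * i + 1) * (realHermite (2 * i)).eval x := by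
    rw [a, show 2 * i + 2 + 1 = 2 * i + 1 + 2 by ring, b]
    push_cast
    linear_combination (-(2 * (i : ℝ) + 2)) * h1
  simp only [evenHermite, e1, e2]
  rw [h4, Nat.factorial_succ (i + 1), Nat.factorial_succ i]
  push_cast
  field_simp
  ring

open PowerSeries in
/-- Laguerre polynomials in the variable `(x ^ 2 + y ^ 2) / 2`, with positive leading
coefficients. -/
noncomputable def radialLaguerre (n : ℕ) (x y : ℝ) : ℝ :=
  coeff n (mk (fun i => evenHermite i x) * mk (fun i => evenHermite i y))

theorem radialLaguerre_eq_sum (n : ℕ) (x y : ℝ) : radialLaguerre n x y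
    = ∑ p ∈ Finset.HasAntidiagonal.antidiagonal n, evenHermite p.1 x * evenHermite p.2 y := by
  simp [radialLaguerre, PowerSeries.coeff_mul]

theorem evenHermite_zero (x : ℝ) : evenHermite 0 x = 1 := by simp [evenHermite, realHermite_zero]

theorem radialLaguerre_zero (x y : ℝ) : radialLaguerre 0 x y = 1 := by
  simp [radialLaguerre_eq_sum, evenHermite_zero]

open PowerSeries in
theorem sq_mul_mk_evenHermite (x : ℝ) :
    C (x ^ 2 / 2) * mk (fun i => evenHermite i x)
      = derivative ℝ (mk fun i => evenHermite i x)
        + C 2 * (X * derivative ℝ (mk fun i => evenHermite i x))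
        + X * (X * derivative ℝ (mk fun i => evenHermite i x))
        + C (1 / 2) * (mk (fun i => evenHermite i x) + X * mk fun i => evenHermite i x) := by
  ext n
  rcases n with _ | _ | n
  · simp only [map_add, coeff_C_mul, coeff_derivative, coeff_mk, coeff_zero_X_mul]
    rw [sq_mul_evenHermite_zero]; push_cast; ring
  · have := sq_mul_evenHermite_succ 0 x
    simp [coeff_C_mul, coeff_derivative, coeff_mk, coeff_succ_X_mul, coeff_zero_X_mul, -one_div]
      at this ⊢
    rw [this]; ring
  · have := sq_mul_evenHermite_succ (n + 1) x
    simp [coeff_C_mul, coeff_derivative, coeff_mk, coeff_succ_X_mul, -one_div] at this ⊢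
    rw [this]; ring

open PowerSeries in
theorem sq_mul_radialLaguerre (n : ℕ) (x y : ℝ) :
    (x ^ 2 + y ^ 2) / 2 * radialLaguerre n x y = (n + 1) * radialLaguerre (n + 1) x y
      + (2 * n + 1) * radialLaguerre n x y + n * radialLaguerre (n - 1) x y := by
  set F := mk (fun i => evenHermite i x) with hF
  set G := mk (fun i => evenHermite i y) with hG
  have key : C ((x ^ 2 + y ^ 2) / 2) * (F * G) = derivative ℝ (F * G)
      + C 2 * (X * derivative ℝ (F * G)) + X * (X * derivative ℝ (F * G))
      + (F * G + X * (F * G)) := by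
    have h1 := sq_mul_mk_evenHermite x
    have h2 := sq_mul_mk_evenHermite y
    rw [← hF] at h1
    rw [← hG] at h2
    have h3 : (C ((x ^ 2 + y ^ 2) / 2) : PowerSeries ℝ) = C (x ^ 2 / 2) + C (y ^ 2 / 2) := by
      rw [← map_add]; congr 1; ring
    have h4 : (C (1 / 2) + C (1 / 2) : PowerSeries ℝ) = 1 := by
      rw [← map_add]; norm_num
    rw [h3, Derivation.leibniz]
    simp only [smul_eq_mul]
    linear_combination G * h1 + F * h2 + (F * G + X * (F * G)) * h4
  have := congrArg (coeff n) key
  unfold radialLaguerre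
  rw [← hF, ← hG]
  rcases n with _ | _ | n
  · simp only [map_add, coeff_C_mul, coeff_derivative, coeff_zero_X_mul] at this
    rw [this]; push_cast; simp
  · simp only [map_add, coeff_C_mul, coeff_derivative, coeff_succ_X_mul, coeff_zero_X_mul] at this
    rw [this]; push_cast; ring
  · simp only [map_add, coeff_C_mul, coeff_derivative, coeff_succ_X_mul] at this
    rw [this]; push_cast; ring

theorem PolyGrowth.evenHermite {E : Type*} [NormedAddCommGroup E] {f : E → ℝ} (hf : PolyGrowth f)
    (i : ℕ) : PolyGrowth (fun x => evenHermite i (f x)) := by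
  simp only [_root_.evenHermite, div_eq_mul_inv]
  exact (hf.polynomial_eval _).mul (PolyGrowth.const _)

theorem PolyGrowth.radialLaguerre {E : Type*} [NormedAddCommGroup E] {f g : E → ℝ}
    (hf : PolyGrowth f) (hg : PolyGrowth g) (n : ℕ) :
    PolyGrowth (fun x => radialLaguerre n (f x) (g x)) := by
  simp only [radialLaguerre_eq_sum]
  exact PolyGrowth.sum _ fun p _ => (hf.evenHermite p.1).mul (hg.evenHermite p.2)

theorem PolyGrowth.fst_id : PolyGrowth (fun p : ℝ × ℝ => p.1) :=
  PolyGrowth.of_norm_le continuous_fst fun p => norm_fst_le p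

theorem PolyGrowth.snd_id : PolyGrowth (fun p : ℝ × ℝ => p.2) :=
  PolyGrowth.of_norm_le continuous_snd fun p => norm_snd_le p

/-- Mehler averaging of the radial Laguerre polynomials. -/
theorem integral_radialLaguerre {r σ : ℝ} (h : r ^ 2 + σ ^ 2 = 1) (x y : ℝ) (n : ℕ) :
    ∫ w : ℝ × ℝ, radialLaguerre n (r * x + σ * w.1) (r * y + σ * w.2)
        ∂((gaussianReal 0 1).prod (gaussianReal 0 1))
      = r ^ (2 * n) * radialLaguerre n x y := by
  have h1 : ∀ i x, ∫ w, evenHermite i (r * x + σ * w) ∂gaussianReal 0 1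
      = r ^ (2 * i) * evenHermite i x := fun i x => by
    simp only [evenHermite]
    rw [integral_div, integral_realHermite h, mul_div_assoc]
  have g : ∀ {f : ℝ × ℝ → ℝ} (x : ℝ), PolyGrowth f → PolyGrowth (fun w => r * x + σ * f w) :=
    fun x hf => (PolyGrowth.const _).add ((PolyGrowth.const _).mul hf)
  simp only [radialLaguerre_eq_sum]
  rw [integral_finsetSum, Finset.mul_sum]
  · refine Finset.sum_congr rfl fun p hp => ?_
    rw [integral_prod_mul (fun w => evenHermite p.1 (r * x + σ * w))
      (fun w => evenHermite p.2 (r * y + σ * w)), h1, h1, ← Finset.HasAntidiagonal.mem_antidiagonal.1 hp]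
    ring
  · exact fun p _ => (((g x PolyGrowth.fst_id).evenHermite _).mul
      ((g y PolyGrowth.snd_id).evenHermite _)).integrable _

theorem measurePreserving_prodProdProdComm {α₁ α₂ α₃ α₄ : Type*} [MeasurableSpace α₁]
    [MeasurableSpace α₂] [MeasurableSpace α₃] [MeasurableSpace α₄] (μ₁ : Measure α₁)
    (μ₂ : Measure α₂) (μ₃ : Measure α₃) (μ₄ : Measure α₄) [SFinite μ₁] [SFinite μ₂] [SFinite μ₃]
    [SFinite μ₄] :
    MeasurePreserving (fun p : (α₁ × α₂) × (α₃ × α₄) => ((p.1.1, p.2.1), (p.1.2, p.2.2)))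
      ((μ₁.prod μ₂).prod (μ₃.prod μ₄)) ((μ₁.prod μ₃).prod (μ₂.prod μ₄)) := by
  have h1 := measurePreserving_prodAssoc μ₁ μ₂ (μ₃.prod μ₄)
  have h2 := (measurePreserving_prodAssoc μ₂ μ₃ μ₄).symm
  have h3 := (Measure.measurePreserving_swap (μ := μ₂) (ν := μ₃)).prod (MeasurePreserving.id μ₄)
  have h4 := measurePreserving_prodAssoc μ₃ μ₂ μ₄
  have h5 := (measurePreserving_prodAssoc μ₁ μ₃ (μ₂.prod μ₄)).symm
  exact h5.comp (((MeasurePreserving.id μ₁).prod (h4.comp (h3.comp h2))).comp h1)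

instance isGaussian_ouLaw {ι : Type*} [Fintype ι] [DecidableEq ι] (t : ι → ℝ) :
    IsGaussian (ouLaw t) := by
  unfold ouLaw; infer_instance

/-- Appending the next value of the autoregression with noise `w`. -/
noncomputable def autoregress (r σ : ℝ) (N : ℕ) (p : EuclideanSpace ℝ (Fin (N + 1)) × ℝ) :
    EuclideanSpace ℝ (Fin (N + 2)) :=
  WithLp.toLp 2 (Fin.snoc (α := fun _ => ℝ) p.1.ofLp (r * p.1 (Fin.last N) + σ * p.2))

theorem autoregress_castSucc (r σ : ℝ) (N : ℕ) (p : EuclideanSpace ℝ (Fin (N + 1)) × ℝ)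
    (k : Fin (N + 1)) : autoregress r σ N p k.castSucc = p.1 k := by
  simp [autoregress]

theorem autoregress_last (r σ : ℝ) (N : ℕ) (p : EuclideanSpace ℝ (Fin (N + 1)) × ℝ) :
    autoregress r σ N p (Fin.last (N + 1)) = r * p.1 (Fin.last N) + σ * p.2 := by
  simp [autoregress]

theorem PolyGrowth.clm {E : Type*} [NormedAddCommGroup E] [NormedSpace ℝ E] (L : E →L[ℝ] ℝ) :
    PolyGrowth (fun x => L x) :=
  ⟨L.continuous, ‖L‖, 1, norm_nonneg _, fun x => by
    have h := L.le_opNorm x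
    rw [Real.norm_eq_abs] at h
    nlinarith [norm_nonneg L]⟩

/-- The autoregression step as a continuous linear map. -/
noncomputable def autoregressCLM (r σ : ℝ) (N : ℕ) :
    EuclideanSpace ℝ (Fin (N + 1)) × ℝ →L[ℝ] EuclideanSpace ℝ (Fin (N + 2)) :=
  (PiLp.continuousLinearEquiv 2 ℝ (fun _ : Fin (N + 2) => ℝ)).symm.toContinuousLinearMap.comp
    (ContinuousLinearMap.pi (Fin.snoc (α := fun _ => EuclideanSpace ℝ (Fin (N + 1)) × ℝ →L[ℝ] ℝ)
      (fun k => (EuclideanSpace.proj k).comp (ContinuousLinearMap.fst ℝ _ _))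
      (r • (EuclideanSpace.proj (Fin.last N)).comp (ContinuousLinearMap.fst ℝ _ _)
        + σ • ContinuousLinearMap.snd ℝ _ _)))

theorem autoregressCLM_apply (r σ : ℝ) (N : ℕ) (p : EuclideanSpace ℝ (Fin (N + 1)) × ℝ) :
    autoregressCLM r σ N p = autoregress r σ N p := by
  ext k
  refine Fin.lastCases ?_ (fun k => ?_) k
  · simp [autoregressCLM, autoregress_last]
  · simp [autoregressCLM, autoregress_castSucc]

theorem covariance_ouLaw {ι : Type*} [Fintype ι] [DecidableEq ι] (t : ι → ℝ) (i j : ι) :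
    cov[fun x => x i, fun x => x j; ouLaw t] = Real.exp (-|t i - t j|) := by
  unfold ouLaw
  rw [covariance_eval_multivariateGaussian (posSemidef_ouCov t)]
  rfl

/-- The Ornstein-Uhlenbeck process on a lattice is an autoregressive process. -/
theorem measurePreserving_autoregress {b : ℝ} (hb : 0 ≤ b) (N : ℕ) {σ : ℝ}
    (hσ : Real.exp (-b) ^ 2 + σ ^ 2 = 1) :
    MeasurePreserving (autoregress (Real.exp (-b)) σ N)
      ((ouLaw (latticeTimes (N + 1) b)).prod (gaussianReal 0 1)) (ouLaw (latticeTimes (N + 2) b)) := by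
  set r := Real.exp (-b) with hr
  set μ := ouLaw (latticeTimes (N + 1) b) with hμ
  have hfun : autoregress r σ N = autoregressCLM r σ N := by
    ext1 p; rw [autoregressCLM_apply]
  refine ⟨by rw [hfun]; fun_prop, ?_⟩
  have hG : IsGaussian ((μ.prod (gaussianReal 0 1)).map (autoregress r σ N)) := by
    rw [hfun]; infer_instance
  have hfst : ∀ k, PolyGrowth
      (fun p : EuclideanSpace ℝ (Fin (N + 1)) × ℝ => p.1 k) := fun k =>
    PolyGrowth.clm ((EuclideanSpace.proj (𝕜 := ℝ) k).comp
      (ContinuousLinearMap.fst ℝ (EuclideanSpace ℝ (Fin (N + 1))) ℝ))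
  have hsnd : PolyGrowth (fun p : EuclideanSpace ℝ (Fin (N + 1)) × ℝ => p.2) :=
    PolyGrowth.of_norm_le continuous_snd fun p => norm_snd_le p
  have hlast := ((PolyGrowth.const r).mul (hfst (Fin.last N))).add ((PolyGrowth.const σ).mul hsnd)
  have hmem : ∀ k, MemLp (fun p => autoregress r σ N p k) 2 (μ.prod (gaussianReal 0 1)) := by
    intro k
    refine Fin.lastCases ?_ (fun k => ?_) k
    · simp only [autoregress_last]
      exact hlast.memLp_two _
    · simp only [autoregress_castSucc]
      exact (hfst k).memLp_two _
  have hff : ∀ i j, cov[fun p : EuclideanSpace ℝ (Fin (N + 1)) × ℝ => p.1 i, fun p => p.1 j;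
      μ.prod (gaussianReal 0 1)] = Real.exp (-(b * |(i : ℝ) - (j : ℝ)|)) := by
    intro i j
    have h : HasLaw (Prod.fst : EuclideanSpace ℝ (Fin (N + 1)) × ℝ → _) μ
        (μ.prod (gaussianReal 0 1)) := ⟨by fun_prop, measurePreserving_fst.map_eq⟩
    have h2 := h.covariance_comp (f := fun x => x i) (g := fun x => x j) (by fun_prop) (by fun_prop)
    rw [hμ, covariance_ouLaw] at h2
    refine h2.trans ?_
    simp only [latticeTimes]
    rw [← mul_sub, abs_mul, abs_of_nonneg hb]
  have hfs : ∀ i, cov[fun p : EuclideanSpace ℝ (Fin (N + 1)) × ℝ => p.1 i, fun p => p.2;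
      μ.prod (gaussianReal 0 1)] = 0 := fun i =>
    (indepFun_prod (X := fun x : EuclideanSpace ℝ (Fin (N + 1)) => x i) (Y := fun w : ℝ => w)
      (by fun_prop) (by fun_prop)).covariance_eq_zero ((hfst i).memLp_two _) (hsnd.memLp_two _)
  have hss : cov[fun p : EuclideanSpace ℝ (Fin (N + 1)) × ℝ => p.2, fun p => p.2;
      μ.prod (gaussianReal 0 1)] = 1 := by
    have h : HasLaw (Prod.snd : EuclideanSpace ℝ (Fin (N + 1)) × ℝ → _) (gaussianReal 0 1)
        (μ.prod (gaussianReal 0 1)) := ⟨by fun_prop, measurePreserving_snd.map_eq⟩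
    have h2 := h.covariance_comp (f := fun x => x) (g := fun x => x) (by fun_prop) (by fun_prop)
    refine h2.trans ?_
    rw [covariance_self (by fun_prop), variance_fun_id_gaussianReal]
    simp
  have hfl : ∀ i, cov[fun p : EuclideanSpace ℝ (Fin (N + 1)) × ℝ => p.1 i,
      fun p => r * p.1 (Fin.last N) + σ * p.2; μ.prod (gaussianReal 0 1)]
      = Real.exp (-(b * |(i : ℝ) - (N + 1)|)) := by
    intro i
    have h := covariance_add_right (μ := μ.prod (gaussianReal 0 1)) ((hfst i).memLp_two _)
      (((PolyGrowth.const r).mul (hfst (Fin.last N))).memLp_two _)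
      (((PolyGrowth.const σ).mul hsnd).memLp_two _)
    refine h.trans ?_
    rw [covariance_const_mul_right, covariance_const_mul_right, hff, hfs, hr, mul_zero, add_zero,
      ← Real.exp_add]
    have hi : (i : ℝ) ≤ N := by exact_mod_cast Nat.lt_succ_iff.1 i.2
    rw [Fin.val_last, abs_of_nonpos (by linarith), abs_of_nonpos (by linarith)]
    ring_nf
  have hcov : ∀ i j, cov[fun p => autoregress r σ N p i, fun p => autoregress r σ N p j;
      μ.prod (gaussianReal 0 1)] = Real.exp (-(b * |(i : ℝ) - (j : ℝ)|)) := by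
    intro i j
    refine Fin.lastCases ?_ (fun i => ?_) i <;> refine Fin.lastCases ?_ (fun j => ?_) j
    · simp only [autoregress_last]
      have h := covariance_add_right (μ := μ.prod (gaussianReal 0 1)) (hlast.memLp_two _)
        (((PolyGrowth.const r).mul (hfst (Fin.last N))).memLp_two _)
        (((PolyGrowth.const σ).mul hsnd).memLp_two _)
      refine h.trans ?_
      have h' := covariance_add_right (μ := μ.prod (gaussianReal 0 1)) (hsnd.memLp_two _)
        (((PolyGrowth.const r).mul (hfst (Fin.last N))).memLp_two _)
        (((PolyGrowth.const σ).mul hsnd).memLp_two _)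
      have h'' : cov[fun p : EuclideanSpace ℝ (Fin (N + 1)) × ℝ => p.2,
          fun p => r * p.1 (Fin.last N) + σ * p.2; μ.prod (gaussianReal 0 1)] = σ := by
        refine h'.trans ?_
        rw [covariance_const_mul_right, covariance_const_mul_right, covariance_comm, hfs, hss]
        ring
      rw [covariance_const_mul_right, covariance_const_mul_right, covariance_comm, hfl,
        covariance_comm, h'', Fin.val_last]
      simp only [sub_self, abs_zero, mul_zero, neg_zero, Real.exp_zero]
      have e : Real.exp (-(b * |(N : ℝ) - (N + 1)|)) = r := by
        rw [show (N : ℝ) - (N + 1) = -1 by ring]; simp [hr]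
      rw [e, ← hσ]; ring
    · simp only [autoregress_last, autoregress_castSucc]
      rw [covariance_comm, hfl, abs_sub_comm]
      simp
    · simp only [autoregress_last, autoregress_castSucc]
      rw [hfl]
      simp
    · simp only [autoregress_castSucc]
      rw [hff]
      simp
  apply IsGaussian.ext
  · have e2 : (ouLaw (latticeTimes (N + 2) b))[id] = 0 := by simp [ouLaw]
    have e1 : ∫ x, x ∂μ = 0 := by simp [hμ, ouLaw]
    have e3 : ∫ w, w ∂gaussianReal 0 1 = 0 := integral_id_gaussianReal
    rw [e2, integral_map (by rw [hfun]; fun_prop) (by fun_prop), hfun]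
    simp only [id]
    have hid : Integrable (fun p : EuclideanSpace ℝ (Fin (N + 1)) × ℝ => p)
        (μ.prod (gaussianReal 0 1)) := IsGaussian.integrable_id
    rw [ContinuousLinearMap.integral_comp_comm _ hid]
    have e4 : ∫ p, p ∂(μ.prod (gaussianReal 0 1)) = 0 := by
      apply Prod.ext
      · rw [← ContinuousLinearMap.coe_fst' (R := ℝ),
          ← ContinuousLinearMap.integral_comp_comm _ hid]
        simpa [e1] using integral_fun_fst (μ := μ) (ν := gaussianReal 0 1) (fun x => x)
      · rw [← ContinuousLinearMap.coe_snd' (R := ℝ),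
          ← ContinuousLinearMap.integral_comp_comm _ hid]
        simpa [e3] using integral_fun_snd (μ := μ) (ν := gaussianReal 0 1) (fun x => x)
    rw [e4, map_zero]
  · ext x y
    rw [show autoregress r σ N = fun p => WithLp.toLp 2 (fun k => autoregress r σ N p k) from rfl,
      covarianceBilin_apply_pi hmem]
    unfold ouLaw
    rw [covarianceBilin_multivariateGaussian (posSemidef_ouCov _)]
    simp only [hcov, ouCov, dotProduct, Matrix.mulVec, Finset.mul_sum, Matrix.of_apply,
      latticeTimes]
    refine Finset.sum_congr rfl fun i _ => Finset.sum_congr rfl fun j _ => ?_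
    rw [← mul_sub, abs_mul, abs_of_nonneg hb]
    ring

section Moment

variable {b : ℝ}

theorem PolyGrowth.proj_fst {ι : Type*} [Fintype ι] (k : ι) :
    PolyGrowth (fun p : EuclideanSpace ℝ ι × EuclideanSpace ℝ ι => p.1 k) :=
  PolyGrowth.clm ((EuclideanSpace.proj (𝕜 := ℝ) k).comp
    (ContinuousLinearMap.fst ℝ (EuclideanSpace ℝ ι) (EuclideanSpace ℝ ι)))

theorem PolyGrowth.proj_snd {ι : Type*} [Fintype ι] (k : ι) :
    PolyGrowth (fun p : EuclideanSpace ℝ ι × EuclideanSpace ℝ ι => p.2 k) :=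
  PolyGrowth.clm ((EuclideanSpace.proj (𝕜 := ℝ) k).comp
    (ContinuousLinearMap.snd ℝ (EuclideanSpace ℝ ι) (EuclideanSpace ℝ ι)))

theorem PolyGrowth.half_sq_add_sq {E : Type*} [NormedAddCommGroup E] {f g : E → ℝ}
    (hf : PolyGrowth f) (hg : PolyGrowth g) : PolyGrowth (fun x => (f x ^ 2 + g x ^ 2) / 2) := by
  simp only [div_eq_mul_inv]
  exact ((hf.pow 2).add (hg.pow 2)).mul (PolyGrowth.const _)

/-- Integrating out the last point. -/
theorem integral_mul_radialLaguerre_last (hb : 0 ≤ b) (N n : ℕ)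
    {g : EuclideanSpace ℝ (Fin (N + 1)) × EuclideanSpace ℝ (Fin (N + 1)) → ℝ}
    {G : EuclideanSpace ℝ (Fin (N + 2)) × EuclideanSpace ℝ (Fin (N + 2)) → ℝ}
    (hGg : ∀ (r σ : ℝ) (p q : EuclideanSpace ℝ (Fin (N + 1)) × ℝ),
      G (autoregress r σ N p, autoregress r σ N q) = g (p.1, q.1))
    (hG : PolyGrowth G) :
    ∫ p, G p * radialLaguerre n (p.1 (Fin.last (N + 1))) (p.2 (Fin.last (N + 1)))
        ∂((ouLaw (latticeTimes (N + 2) b)).prod (ouLaw (latticeTimes (N + 2) b)))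
      = Real.exp (-b) ^ (2 * n) * ∫ p, g p * radialLaguerre n (p.1 (Fin.last N)) (p.2 (Fin.last N))
        ∂((ouLaw (latticeTimes (N + 1) b)).prod (ouLaw (latticeTimes (N + 1) b))) := by
  set r := Real.exp (-b) with hr
  set σ := Real.sqrt (1 - r ^ 2) with hσ
  have hr1 : r ≤ 1 := Real.exp_le_one_iff.2 (by linarith)
  have hr0 : 0 ≤ r := (Real.exp_pos _).le
  have hrσ : r ^ 2 + σ ^ 2 = 1 := by rw [hσ, Real.sq_sqrt (by nlinarith)]; ring
  have hmp := (measurePreserving_autoregress hb N (σ := σ) hrσ)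
  have hmp2 := (hmp.prod hmp).comp (measurePreserving_prodProdProdComm
    (ouLaw (latticeTimes (N + 1) b)) (ouLaw (latticeTimes (N + 1) b))
    (gaussianReal 0 1) (gaussianReal 0 1))
  set Φ := Prod.map (autoregress r σ N) (autoregress r σ N) ∘
    fun p : (EuclideanSpace ℝ (Fin (N + 1)) × EuclideanSpace ℝ (Fin (N + 1))) × (ℝ × ℝ) =>
      ((p.1.1, p.2.1), (p.1.2, p.2.2)) with hΦ
  have hgr := (hG.mul ((PolyGrowth.proj_fst (Fin.last (N + 1))).radialLaguerre
    (PolyGrowth.proj_snd (Fin.last (N + 1))) n))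
  have hint := hgr.integrable
    ((ouLaw (latticeTimes (N + 2) b)).prod (ouLaw (latticeTimes (N + 2) b)))
  have hint2 := (hmp2.integrable_comp hint.aestronglyMeasurable).2 hint
  rw [← hmp2.map_eq, integral_map hmp2.measurable.aemeasurable
    hgr.1.aestronglyMeasurable]
  have hval : ∀ p : (EuclideanSpace ℝ (Fin (N + 1)) × EuclideanSpace ℝ (Fin (N + 1))) × (ℝ × ℝ),
      G (Φ p) * radialLaguerre n ((Φ p).1 (Fin.last (N + 1))) ((Φ p).2 (Fin.last (N + 1)))
        = g p.1 * radialLaguerre n (r * p.1.1 (Fin.last N) + σ * p.2.1)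
          (r * p.1.2 (Fin.last N) + σ * p.2.2) := by
    intro p
    simp only [hΦ, Function.comp_apply, Prod.map_apply, hGg, autoregress_last]
  have hint3 : Integrable (fun p : (EuclideanSpace ℝ (Fin (N + 1))
      × EuclideanSpace ℝ (Fin (N + 1))) × (ℝ × ℝ) =>
      g p.1 * radialLaguerre n (r * p.1.1 (Fin.last N) + σ * p.2.1)
          (r * p.1.2 (Fin.last N) + σ * p.2.2))
      (((ouLaw (latticeTimes (N + 1) b)).prod (ouLaw (latticeTimes (N + 1) b))).prod
        ((gaussianReal 0 1).prod (gaussianReal 0 1))) :=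
    hint2.congr (Eventually.of_forall fun p => hval p)
  simp only [hval]
  rw [integral_prod _ hint3, ← integral_const_mul]
  congr 1
  ext p
  simp only
  rw [integral_const_mul, integral_radialLaguerre hrσ]
  ring

/-- Mixed moments of the radial part along the lattice. -/
noncomputable def radialMoment (b : ℝ) (N n : ℕ) : ℝ :=
  ∫ p, (∏ k : Fin N, ((p.1 k.castSucc) ^ 2 + (p.2 k.castSucc) ^ 2) / 2)
      * radialLaguerre n (p.1 (Fin.last N)) (p.2 (Fin.last N))
    ∂((ouLaw (latticeTimes (N + 1) b)).prod (ouLaw (latticeTimes (N + 1) b)))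

theorem polyGrowth_prod_half_sq {ι κ : Type*} [Fintype ι] [Fintype κ] (f : κ → ι) :
    PolyGrowth (fun p : EuclideanSpace ℝ ι × EuclideanSpace ℝ ι =>
      ∏ k, ((p.1 (f k)) ^ 2 + (p.2 (f k)) ^ 2) / 2) :=
  PolyGrowth.prod _ fun k _ =>
    (PolyGrowth.proj_fst (f k)).half_sq_add_sq (PolyGrowth.proj_snd (f k))

theorem integral_prod_mul_radialLaguerre (b : ℝ) (N n : ℕ) :
    ∫ p, (∏ k : Fin (N + 1), ((p.1 k) ^ 2 + (p.2 k) ^ 2) / 2)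
        * radialLaguerre n (p.1 (Fin.last N)) (p.2 (Fin.last N))
        ∂((ouLaw (latticeTimes (N + 1) b)).prod (ouLaw (latticeTimes (N + 1) b)))
      = (n + 1) * radialMoment b N (n + 1) + (2 * n + 1) * radialMoment b N n
        + n * radialMoment b N (n - 1) := by
  have hI : ∀ (c : ℝ) (m : ℕ), Integrable
      (fun p : EuclideanSpace ℝ (Fin (N + 1)) × EuclideanSpace ℝ (Fin (N + 1)) =>
        c * ((∏ k : Fin N, ((p.1 k.castSucc) ^ 2 + (p.2 k.castSucc) ^ 2) / 2)
        * radialLaguerre m (p.1 (Fin.last N)) (p.2 (Fin.last N))))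
      ((ouLaw (latticeTimes (N + 1) b)).prod (ouLaw (latticeTimes (N + 1) b))) := fun c m =>
    ((PolyGrowth.const c).mul ((polyGrowth_prod_half_sq (Fin.castSucc (n := N))).mul
      ((PolyGrowth.proj_fst (Fin.last N)).radialLaguerre
        (PolyGrowth.proj_snd (Fin.last N)) m))).integrable _
  unfold radialMoment
  rw [← integral_const_mul, ← integral_const_mul, ← integral_const_mul,
    ← integral_add (hI _ _) (hI _ _)]
  refine Eq.trans ?_ (integral_add ((hI (n + 1) (n + 1)).add (hI (2 * n + 1) n)) (hI n (n - 1)))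
  congr 1
  ext p
  simp only
  rw [Fin.prod_univ_castSucc]
  have := sq_mul_radialLaguerre n (p.1 (Fin.last N)) (p.2 (Fin.last N))
  linear_combination (∏ k : Fin N, ((p.1 k.castSucc) ^ 2 + (p.2 k.castSucc) ^ 2) / 2) * this

theorem integral_radialLaguerre_std (n : ℕ) :
    ∫ w : ℝ × ℝ, radialLaguerre n w.1 w.2 ∂((gaussianReal 0 1).prod (gaussianReal 0 1))
      = if n = 0 then 1 else 0 := by
  have := integral_radialLaguerre (r := 0) (σ := 1) (by norm_num) 0 0 n
  simp only [zero_mul, one_mul, zero_add] at this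
  rw [this]
  split_ifs with h
  · simp [h, radialLaguerre_zero]
  · rw [zero_pow (by omega), zero_mul]

theorem radialMoment_eq (hb : 0 ≤ b) (N n : ℕ) :
    radialMoment b N n = Real.exp (-b) ^ n * chainWeight (Real.exp (-b)) N n := by
  induction N generalizing n with
  | zero =>
    have h1 : MeasurePreserving (fun x : EuclideanSpace ℝ (Fin 1) => x (Fin.last 0))
        (ouLaw (latticeTimes 1 b)) (gaussianReal 0 1) := by
      have := measurePreserving_eval_multivariateGaussian (μ := 0)
        (posSemidef_ouCov (latticeTimes 1 b)) (i := Fin.last 0)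
      simpa [ouLaw, ouCov] using this
    have h2 := h1.prod h1
    have h3 := integral_radialLaguerre_std n
    rw [← h2.map_eq, integral_map h2.measurable.aemeasurable
      (PolyGrowth.fst_id.radialLaguerre PolyGrowth.snd_id n).1.aestronglyMeasurable] at h3
    simp only [radialMoment, chainWeight, Finset.univ_eq_empty, Finset.prod_empty, one_mul]
    refine h3.trans ?_
    split_ifs with h
    · simp [h]
    · simp
  | succ N ih =>
    have h := integral_mul_radialLaguerre_last hb N n
      (g := fun p => ∏ k : Fin (N + 1), ((p.1 k) ^ 2 + (p.2 k) ^ 2) / 2)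
      (G := fun p => ∏ k : Fin (N + 1), ((p.1 k.castSucc) ^ 2 + (p.2 k.castSucc) ^ 2) / 2)
      (fun r σ p q => by simp only [autoregress_castSucc]) (polyGrowth_prod_half_sq _)
    simp only [integral_prod_mul_radialLaguerre, ih] at h
    refine h.trans ?_
    simp only [chainWeight]
    ring

theorem gaussianMoment_eq (hb : 0 ≤ b) {N : ℕ} (hN : 1 ≤ N) :
    gaussianMoment N b = 2 ^ N * chainWeight (Real.exp (-b)) N 0 := by
  obtain ⟨N, rfl⟩ : ∃ M, N = M + 1 := ⟨N - 1, by omega⟩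
  have h := integral_prod_mul_radialLaguerre b N 0
  simp only [radialLaguerre_zero, mul_one, radialMoment_eq hb] at h
  have h2 : gaussianMoment (N + 1) b = 2 ^ (N + 1) *
      ∫ p, (∏ k : Fin (N + 1), ((p.1 k) ^ 2 + (p.2 k) ^ 2) / 2)
        ∂((ouLaw (latticeTimes (N + 1) b)).prod (ouLaw (latticeTimes (N + 1) b))) := by
    rw [gaussianMoment, ← integral_const_mul]
    congr 1
    ext p
    rw [Finset.prod_div_distrib]
    simp
    field_simp
  rw [h2, h]
  simp only [chainWeight]
  push_cast
  ring

end Moment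

theorem log_gaussianMoment_long {b : ℝ} (hb : 0 < b) (hb1 : b ≤ 1 / 100) {N : ℕ}
    (hN : 2 ≤ N * b) :
    |1 / (N : ℝ) * Real.log (gaussianMoment N b) - (Real.log (4 / b) - 1)|
      ≤ 24 * (b + 1 / (b * N)) := by
  have hN1 : 1 ≤ N := Nat.one_le_iff_ne_zero.2 fun h => by rw [h] at hN; norm_num at hN
  have hN0 : (0 : ℝ) < N := by exact_mod_cast hN1
  have hlow := chainWeight_zero_ge hb hb1 hN
  have hup := chainWeight_exp_le hb N 0
  have hpos : 0 < chainWeight (Real.exp (-b)) N 0 := lt_of_lt_of_le (by positivity) hlow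
  have l1 := Real.log_le_log (by positivity) hlow
  have l2 := Real.log_le_log hpos hup
  rw [Real.log_mul (by positivity) (by positivity), Real.log_pow,
    Real.log_mul (by positivity) (by positivity), Real.log_exp, Real.log_exp] at l1
  rw [Real.log_pow, Real.log_mul (by positivity) (by positivity),
    Real.log_mul (by positivity) (by positivity), Real.log_exp, Real.log_exp] at l2
  have h4 : Real.log (4 / b) = Real.log 2 + Real.log (2 / b) := by
    rw [← Real.log_mul (by norm_num) (by positivity)]; ring_nf
  rw [gaussianMoment_eq hb.le hN1, Real.log_mul (by positivity) hpos.ne', Real.log_pow, h4]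
  set D := Real.log (chainWeight (Real.exp (-b)) N 0)
  have e : 1 / (N : ℝ) * (N * Real.log 2 + D) - (Real.log 2 + Real.log (2 / b) - 1)
      = (D - N * (Real.log (2 / b) + -1)) / N := by field_simp; ring
  rw [e, abs_le, le_div_iff₀ hN0, div_le_iff₀ hN0]
  have e2 : 24 * (b + 1 / (b * N)) * N = 24 * (b * N + 1 / b) := by field_simp
  constructor
  · rw [neg_mul, e2]; linarith
  · rw [e2]
    have : 0 < 1 / b := by positivity
    nlinarith

theorem log_gaussianMoment_short {b : ℝ} (hb : 0 < b) {N : ℕ} (hN : 1 ≤ N)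
    (hbN : 2 * b * N ≤ 1) :
    |1 / (N : ℝ) * Real.log (gaussianMoment N b)
      - (1 / (N : ℝ) * Real.log N.factorial + Real.log 2
        - b * ((N : ℝ) / 3 - 1 / (3 * (N : ℝ))))| ≤ 4 * (b ^ 2 * (N : ℝ) ^ 2) := by
  have hN0 : (0 : ℝ) < N := by exact_mod_cast hN
  have hlow := chainWeight_ge_of_permanent (b := b) N hN 0
  have hup := chainWeight_le_of_permanent hb.le N hN hbN 0
  simp only [Nat.choose_zero_right, Nat.cast_one, mul_one, Nat.cast_zero, mul_zero,
    zero_add] at hlow hup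
  have hf : (0 : ℝ) < N.factorial := by exact_mod_cast N.factorial_pos
  have hpos : 0 < chainWeight (Real.exp (-b)) N 0 := lt_of_lt_of_le (by positivity) hlow
  have l1 := Real.log_le_log (by positivity) hlow
  have l2 := Real.log_le_log hpos hup
  rw [Real.log_mul (by positivity) (by positivity), Real.log_exp] at l1
  rw [Real.log_mul (by positivity) (by positivity),
    Real.log_mul (by positivity) (by positivity), Real.log_exp, Real.log_exp] at l2
  rw [gaussianMoment_eq hb.le hN, Real.log_mul (by positivity) hpos.ne', Real.log_pow]
  set D := Real.log (chainWeight (Real.exp (-b)) N 0)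
  have e : 1 / (N : ℝ) * (N * Real.log 2 + D) - (1 / (N : ℝ) * Real.log N.factorial + Real.log 2
        - b * ((N : ℝ) / 3 - 1 / (3 * (N : ℝ))))
      = (D - (Real.log N.factorial + -(b * (((N : ℝ) ^ 2 - 1) / 3)))) / N := by field_simp; ring
  have e2 : 4 * (b ^ 2 * (N : ℝ) ^ 2) * N = 4 * b ^ 2 * (N : ℝ) ^ 3 := by ring
  have h0 : 0 ≤ 4 * b ^ 2 * (N : ℝ) ^ 3 := by positivity
  rw [e, abs_le, le_div_iff₀ hN0, div_le_iff₀ hN0, neg_mul, e2]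
  constructor <;> linarith

theorem proposition2p1 (β : ℕ → ℝ) (hβ : ∀ N, 1 ≤ N → 0 < β N) :
    ((fun N : ℕ => 1 / (N : ℝ)) =o[atTop] β → β =o[atTop] (fun _ : ℕ => (1 : ℝ)) →
      ∃ r₁ r₂ : ℕ → ℝ,
        r₁ =O[atTop] β ∧ r₂ =O[atTop] (fun N : ℕ => 1 / (β N * (N : ℝ))) ∧
        ∀ N : ℕ, 1 ≤ N →
          1 / (N : ℝ) * Real.log (gaussianMoment N (β N))
            = Real.log (4 / β N) - 1 + r₁ N + r₂ N) ∧
    (β =o[atTop] (fun N : ℕ => 1 / (N : ℝ)) →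
      ∃ r : ℕ → ℝ,
        r =O[atTop] (fun N : ℕ => (β N) ^ 2 * (N : ℝ) ^ 2) ∧
        ∀ N : ℕ, 1 ≤ N →
          1 / (N : ℝ) * Real.log (gaussianMoment N (β N))
            = 1 / (N : ℝ) * Real.log (N.factorial : ℝ) + Real.log 2
              - β N * ((N : ℝ) / 3 - 1 / (3 * (N : ℝ))) + r N) := by
  constructor
  · intro h1 h2
    set e : ℕ → ℝ := fun N =>
      1 / (N : ℝ) * Real.log (gaussianMoment N (β N)) - (Real.log (4 / β N) - 1) with he
    have hev : ∀ᶠ N : ℕ in atTop, 1 ≤ N ∧ |e N| ≤ 24 * (β N + 1 / (β N * N)) := by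
      filter_upwards [h1.def (c := 1 / 2) (by norm_num), h2.def (c := 1 / 100) (by norm_num),
        eventually_ge_atTop 1] with N a1 a2 hN
      refine ⟨hN, ?_⟩
      have hb := hβ N hN
      have hN0 : (0 : ℝ) < N := by exact_mod_cast hN
      rw [Real.norm_eq_abs, Real.norm_eq_abs, abs_of_pos hb, abs_of_pos (by positivity),
        div_le_iff₀ hN0] at a1
      rw [Real.norm_eq_abs, abs_of_pos hb, norm_one, mul_one] at a2
      exact log_gaussianMoment_long hb a2 (by linarith)
    refine ⟨fun N => e N * (β N / (β N + 1 / (β N * N))),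
      fun N => e N * (1 / (β N * N) / (β N + 1 / (β N * N))), ?_, ?_, ?_⟩
    · refine IsBigO.of_bound 24 ?_
      filter_upwards [hev] with N ⟨hN, h⟩
      have hb := hβ N hN
      have hN0 : (0 : ℝ) < N := by exact_mod_cast hN
      rw [norm_mul, Real.norm_eq_abs, Real.norm_of_nonneg (by positivity),
        Real.norm_of_nonneg hb.le]
      calc _ ≤ 24 * (β N + 1 / (β N * N)) * (β N / (β N + 1 / (β N * N))) := by gcongr
        _ = _ := by field_simp
    · refine IsBigO.of_bound 24 ?_
      filter_upwards [hev] with N ⟨hN, h⟩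
      have hb := hβ N hN
      have hN0 : (0 : ℝ) < N := by exact_mod_cast hN
      rw [norm_mul, Real.norm_eq_abs, Real.norm_of_nonneg (by positivity),
        Real.norm_of_nonneg (by positivity)]
      calc _ ≤ 24 * (β N + 1 / (β N * N)) * (1 / (β N * N) / (β N + 1 / (β N * N))) := by gcongr
        _ = _ := by field_simp
    · intro N hN
      have hb := hβ N hN
      have hN0 : (0 : ℝ) < N := by exact_mod_cast hN
      have hsum : e N * (β N / (β N + 1 / (β N * N)))
          + e N * (1 / (β N * N) / (β N + 1 / (β N * N))) = e N := by
        rw [← mul_add, ← add_div, div_self (by positivity), mul_one]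
      rw [add_assoc, hsum, he]
      ring
  · intro h
    refine ⟨fun N => 1 / (N : ℝ) * Real.log (gaussianMoment N (β N))
      - (1 / (N : ℝ) * Real.log N.factorial + Real.log 2
        - β N * ((N : ℝ) / 3 - 1 / (3 * (N : ℝ)))), ?_, fun N _ => by ring⟩
    refine IsBigO.of_bound 4 ?_
    filter_upwards [h.def (c := 1 / 2) (by norm_num), eventually_ge_atTop 1] with N a1 hN
    have hb := hβ N hN
    have hN0 : (0 : ℝ) < N := by exact_mod_cast hN
    rw [Real.norm_eq_abs, Real.norm_eq_abs, abs_of_pos hb, abs_of_pos (by positivity)] at a1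
    rw [Real.norm_eq_abs, Real.norm_of_nonneg (by positivity)]
    refine log_gaussianMoment_short hb hN ?_
    calc 2 * β N * N ≤ 2 * (1 / 2 * (1 / N)) * N := by gcongr
      _ = 1 := by field_simp
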